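/- **Setting.** There are $N$ independent linear processes $x_n(t+1)=A_nx_n(t)+w_n(t)$, $y_n(t)=C_nx_n(t)+v_n(t)$, $n=1,\dots,N$, with independent zero-mean Gaussian white noises of covariances $W_n$, $V_n$. Each sensor runs a local Kalman filter which is stable and operates in steady state: with $P_n^-=A_n\bar P_nA_n^\top+W_n$, innovation covariance $C_nP_n^-C_n^\top+V_n$ invertible, and gain $K_n=P_n^-C_n^\top(C_nP_n^-C_n^\top+V_n)^{-1}$, the posterior error covariance $\bar P_n$ satisfies $\bar P_n=(I-K_nC_n)P_n^-$, the matrix $(I-K_nC_n)A_n$ has spectral radius less than $1$, and the initial local estimation error has covariance $\bar P_n$. Let $x^s_n(t)$ be the local estimate. There are $M$ frequency channels, $1\le M<N$; the channel state $h(t)$ is an irreducible aperiodic Markov chain on a set $\{h_1,\dots,h_{\bar M}\}\subseteq\{0,1\}^M$ of distinct vectors, with transition matrix $\mathbf M=(p_{i,j})$ and any initial law, and is independent of the processes and sensors; channel $m$ is on in state $h_i$ iff $h_{i,m}=1$. At time $t$ the gateway knows the current state $h(t)$ and schedules $\nu(t)=\pi(\phi(t),h(t))\in\{0,1,\dots,M\}^N$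 by a deterministic stationary policy $\pi$, where $\nu_n(t)=0$ means that sensor $n$ is not scheduled and no channel is assigned to two sensors. The packet $x_n^s(t)$ is received ($\gamma_n(t)=1$) iff $\nu_n(t)\neq0$ and channel $\nu_n(t)$ is on in state $h(t)$. The age of information is $\phi_n(1)=1$, with $\phi_n(t+1)=1$ if $\gamma_n(t)=1$ and $\phi_n(t+1)=\phi_n(t)+1$ otherwise. The remote estimate is $\hat x_n(1)=A_nx_n^s(0)$, with $\hat x_n(t+1)=A_nx^s_n(t)$ if $\gamma_n(t)=1$ and $\hat x_n(t+1)=A_n\hat x_n(t)$ otherwise. The system is *stable* if there is a policy $\pi$ with $$J=\sum_{n=1}^N\limsup_{T\to\infty}\frac1T\sum_{t=1}^T\mathsf E\,\|\hat x_n(t)-x_n(t)\|^2<\infty .$$ **Theorem.** Let $\rho(\cdot)$ denote the spectral radius and $\rho_{\max}=\max_n\rho(A_n)$. For $v\in\{1,\dots,M\}^{\bar M}$ let $V(v)$ be the diagonal matrix with $[V(v)]_{i,i}=1$ if channel $v_i$ is off in state $h_i$ and $[V(v)]_{i,i}=0$ otherwise, and let $$\lambda'_L=\min_{v_1,\dots,v_L\in\{1,\dots,M\}^{\bar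 M}}\rho\big(V(v_1)\mathbf M\,V(v_2)\mathbf M\cdots V(v_L)\mathbf M\big)^{1/L},\qquad \lambda'_\infty=\liminf_{L\to\infty}\lambda'_L .$$ Then the system is stable if and only if $\rho_{\max}^2\,\lambda'_\infty<1$. Moreover $\lambda'_\infty=\lambda'_1$; there is a vector $v^\star$ with $V(v^\star)\le V(v)$ element-wise for all $v$, and for any such $v^\star$ and every $L\ge1$ the minimum defining $\lambda'_L$ is attained at $v_1=\dots=v_L=v^\star$. -/

import Mathlib

open MeasureTheory ProbabilityTheory Filter
open scoped ENNReal Matrix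

namespace RemoteEstimation

noncomputable section

/-- Spectral radius of a real square matrix: the largest absolute value of its complex
eigenvalues. -/
def specRad {ι : Type*} [Fintype ι] [DecidableEq ι] (A : Matrix ι ι ℝ) : ℝ :=
  (spectralRadius ℂ (A.map ((↑) : ℝ → ℂ))).toReal

/-- Data of one linear time-invariant process `x(t+1) = A x(t) + w(t)`, `y(t) = C x(t) + v(t)`
with its sensor: `W`, `V` are the covariances of the noises `w`, `v`, and `Pbar` is the
steady-state posterior error covariance of the local Kalman filter. -/
structure Plant where
  /-- dimension of the state -/
  l : ℕ
  /-- dimension of the measurement -/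
  r : ℕ
  A : Matrix (Fin l) (Fin l) ℝ
  C : Matrix (Fin r) (Fin l) ℝ
  W : Matrix (Fin l) (Fin l) ℝ
  V : Matrix (Fin r) (Fin r) ℝ
  Pbar : Matrix (Fin l) (Fin l) ℝ

namespace Plant

variable (p : Plant)

/-- The state space `ℝ^l` with its Euclidean norm. -/
abbrev X : Type := EuclideanSpace ℝ (Fin p.l)

/-- The measurement space `ℝ^r` with its Euclidean norm. -/
abbrev Y : Type := EuclideanSpace ℝ (Fin p.r)

/-- Prior error covariance `P(t|t-1)` of the local Kalman filter in steady state. -/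
def priorCov : Matrix (Fin p.l) (Fin p.l) ℝ := p.A * p.Pbar * p.Aᵀ + p.W

/-- Innovation covariance `C P(t|t-1) Cᵀ + V` of the local Kalman filter in steady state. -/
def innovCov : Matrix (Fin p.r) (Fin p.r) ℝ := p.C * p.priorCov * p.Cᵀ + p.V

/-- Kalman gain in steady state. -/
def gain : Matrix (Fin p.l) (Fin p.r) ℝ := p.priorCov * p.Cᵀ * p.innovCov⁻¹

/-- The noise covariances are covariance matrices, and the local Kalman filter is stable and
operates in steady state: the gain is well defined, `Pbar` is a fixed point of the covariance
recursion, and the error dynamics `(I - K C) A` of the filter is (Schur) stable. -/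
structure SteadyKalman : Prop where
  posSemidef_W : p.W.PosSemidef
  posSemidef_V : p.V.PosSemidef
  posSemidef_Pbar : p.Pbar.PosSemidef
  isUnit_innovCov : IsUnit p.innovCov.det
  steady : (1 - p.gain * p.C) * p.priorCov = p.Pbar
  stable : specRad ((1 - p.gain * p.C) * p.A) < 1

end Plant

/-- Data of an `M`-channel Markov channel with `K` vector states: `on i m` tells whether the
`m`-th frequency channel is on (successful transmission) in the `i`-th state, and `P` is the
transition probability matrix. -/
structure Channel (M K : ℕ) where
  on : Fin K → Fin M → Bool
  P : Matrix (Fin K) (Fin K) ℝ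

namespace Channel

variable {M K : ℕ} (c : Channel M K)

/-- The vector states are distinct and `P` is the transition matrix of an irreducible aperiodic
Markov chain on them. -/
structure Ergodic : Prop where
  injective : Function.Injective c.on
  stochastic : c.P ∈ Matrix.rowStochastic ℝ (Fin K)
  irreducible : c.P.IsIrreducible
  aperiodic : ∀ i, ∀ d : ℕ, (∀ k : ℕ, 1 ≤ k → 0 < (c.P ^ k) i i → d ∣ k) → d = 1

/-- The diagonal failure indicator `V(v)` of a channel selection vector `v`: its `i`-th diagonal
entry is `1` if channel `v i` is off in the channel state `i`, and `0` otherwise. -/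
def failure (v : Fin K → Fin M) : Matrix (Fin K) (Fin K) ℝ :=
  Matrix.diagonal fun i => if c.on i (v i) then 0 else 1

/-- `ρ(V(v₁) P V(v₂) P ⋯ V(v_L) P) ^ (1 / L)`. -/
def prodRate (L : ℕ) (v : Fin L → Fin K → Fin M) : ℝ :=
  specRad (List.ofFn fun k : Fin L => c.failure (v k) * c.P).prod ^ (1 / (L : ℝ))

/-- `λ'_L`, the minimum (over a finite set) of `prodRate L v`. -/
def rate (L : ℕ) : ℝ := ⨅ v : Fin L → Fin K → Fin M, c.prodRate L v

/-- `λ'_∞ = liminf λ'_L`. -/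
def rateInf : ℝ := liminf c.rate atTop

end Channel

/-- A deterministic stationary scheduling policy with known current channel state: it maps the
AoI vector and the current channel state to the frequency channel of each sensor (`none` if the
sensor is not scheduled). Each packet takes at most one frequency channel, and each frequency
channel carries at most one packet. -/
structure Policy (N M K : ℕ) where
  sel : (Fin N → ℕ) → Fin K → Fin N → Option (Fin M)
  exclusive : ∀ φ i n n' m, sel φ i n = some m → sel φ i n' = some m → n = n'

/-- The random elements driving the system: channel state `h t` (as the index of a vector state),
noises `w n t` and `v n t`, initial process states `x0 n` and initial local estimates `xs0 n`. -/
structure Sources (Ω : Type*) {N : ℕ} (p : Fin N → Plant) (K : ℕ) where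
  h : ℕ → Ω → Fin K
  w : (n : Fin N) → ℕ → Ω → (p n).X
  v : (n : Fin N) → ℕ → Ω → (p n).Y
  x0 : (n : Fin N) → Ω → (p n).X
  xs0 : (n : Fin N) → Ω → (p n).X

/-- Index set of the independent random sources. -/
inductive SourceIdx (N : ℕ) where
  | channel : SourceIdx N
  | init (n : Fin N) : SourceIdx N
  | w (n : Fin N) (t : ℕ) : SourceIdx N
  | v (n : Fin N) (t : ℕ) : SourceIdx N

namespace Sources

variable {Ω : Type*} {N M K : ℕ} {p : Fin N → Plant} (s : Sources Ω p K)

/-- The σ-algebra generated by a source. -/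
@[reducible]
def sigma : SourceIdx N → MeasurableSpace Ω
  | .channel => ⨆ t, MeasurableSpace.comap (s.h t) ⊤
  | .init n => MeasurableSpace.comap (fun ω => (s.x0 n ω, s.xs0 n ω)) inferInstance
  | .w n t => MeasurableSpace.comap (s.w n t) inferInstance
  | .v n t => MeasurableSpace.comap (s.v n t) inferInstance

/-- The probabilistic assumptions: the channel is a Markov chain with transition matrix `c.P`
(and any initial law), the noises are zero-mean Gaussian with covariances `W`, `V`, the initial
local estimation error has the steady-state covariance `Pbar`, and the channel process, the
initial conditions of the different plants and all noise vectors are mutually independent. -/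
structure IsModel [MeasurableSpace Ω] (c : Channel M K) (μ : Measure Ω) : Prop where
  measurable_h : ∀ t, Measurable (s.h t)
  measurable_w : ∀ n t, Measurable (s.w n t)
  measurable_v : ∀ n t, Measurable (s.v n t)
  measurable_x0 : ∀ n, Measurable (s.x0 n)
  measurable_xs0 : ∀ n, Measurable (s.xs0 n)
  markov : ∀ (t : ℕ) (i : ℕ → Fin K),
    μ.real {ω | ∀ k ≤ t, s.h k ω = i k} =
      μ.real {ω | s.h 0 ω = i 0} * ∏ k ∈ Finset.range t, c.P (i k) (i (k + 1))
  law_w : ∀ n t, HasLaw (s.w n t) (multivariateGaussian 0 (p n).W) μ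
  law_v : ∀ n t, HasLaw (s.v n t) (multivariateGaussian 0 (p n).V) μ
  memLp_init : ∀ n, MemLp (fun ω => s.xs0 n ω - s.x0 n ω) 2 μ
  cov_init : ∀ n i j,
    ∫ ω, (s.xs0 n ω - s.x0 n ω) i * (s.xs0 n ω - s.x0 n ω) j ∂μ = (p n).Pbar i j
  indep : iIndep s.sigma μ

/-- Process state `x_n(t)`. -/
def x (n : Fin N) : ℕ → Ω → (p n).X
  | 0, ω => s.x0 n ω
  | t + 1, ω => (p n).A.toEuclideanLin (x n t ω) + s.w n t ω

/-- Measurement `y_n(t)`. -/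
def y (n : Fin N) (t : ℕ) (ω : Ω) : (p n).Y :=
  (p n).C.toEuclideanLin (s.x n t ω) + s.v n t ω

/-- Posterior estimate `x^s_n(t)` of the local (steady-state) Kalman filter. -/
def xs (n : Fin N) : ℕ → Ω → (p n).X
  | 0, ω => s.xs0 n ω
  | t + 1, ω =>
      let prior := (p n).A.toEuclideanLin (xs n t ω)
      prior + (p n).gain.toEuclideanLin (s.y n (t + 1) ω - (p n).C.toEuclideanLin prior)

/-- Successful reception `γ_n(t) = 1` of the packet of sensor `n`, when the AoI vector is `φ`:
the sensor is scheduled on a frequency channel that is on in the current channel state. -/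
def Received (c : Channel M K) (π : Policy N M K) (φ : Fin N → ℕ) (n : Fin N) (t : ℕ) (ω : Ω) :
    Prop :=
  ∃ m, π.sel φ (s.h t ω) n = some m ∧ c.on (s.h t ω) m = true

open Classical in
/-- Age of information `φ_n(t)`. The initial value at time `0` is `0`, so that `φ_n(1) = 1`
whatever happens at time `0`. -/
def aoi (c : Channel M K) (π : Policy N M K) : ℕ → Ω → Fin N → ℕ
  | 0, _ => fun _ => 0
  | t + 1, ω => fun n =>
      if s.Received c π (aoi c π t ω) n t ω then 1 else aoi c π t ω n + 1

open Classical in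
/-- Remote estimate of process `n` at time `t`. It starts from the local estimate at time `0`, so
that the estimate at time `1` is `A_n x^s_n(0)`, in agreement with `φ_n(1) = 1`. -/
def xhat (c : Channel M K) (π : Policy N M K) (n : Fin N) : ℕ → Ω → (p n).X
  | 0, ω => s.xs n 0 ω
  | t + 1, ω =>
      if s.Received c π (s.aoi c π t ω) n t ω then (p n).A.toEuclideanLin (s.xs n t ω)
      else (p n).A.toEuclideanLin (xhat c π n t ω)

/-- Mean-square error `E[Tr P_n(t)] = E ‖xhat_n(t) - x_n(t)‖²` of the remote estimate. -/
def mse [MeasurableSpace Ω] (μ : Measure Ω) (c : Channel M K) (π : Policy N M K) (n : Fin N)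
    (t : ℕ) : ℝ≥0∞ :=
  ∫⁻ ω, ‖s.xhat c π n t ω - s.x n t ω‖ₑ ^ 2 ∂μ

/-- The sum average estimation mean-square error
`J = ∑_n limsup_T (1 / T) ∑_{t=1}^T E[Tr P_n(t)]`. -/
def avgCost [MeasurableSpace Ω] (μ : Measure Ω) (c : Channel M K) (π : Policy N M K) : ℝ≥0∞ :=
  ∑ n : Fin N,
    limsup (fun T : ℕ => (∑ t ∈ Finset.Icc 1 T, s.mse μ c π n t) / (T : ℝ≥0∞)) atTop

/-- Average mean-square stability (stabilizability): some deterministic stationary policy has a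
bounded sum average mean-square error. -/
def Stabilizable [MeasurableSpace Ω] (μ : Measure Ω) (c : Channel M K) : Prop :=
  ∃ π : Policy N M K, s.avgCost μ c π < ∞

end Sources

end

end RemoteEstimation

/-! The error of a remote estimate of age φ depends only on the initial condition and the noises of
its plant, while φ depends only on the channel. Independence gives E‖error‖² = E tr `ageCov` φ
(`IsModel.mse_eq`). This trace is at most C r^φ for any r ≥ 1 above ρ(A)², and, if ρ(A) ≥ 1, at
least d ∑_{j<φ} ρ(A)^{2j} with d > 0, because a stable Kalman filter forces strict growth along a
dominant mode. Stability becomes a question about exponential moments of the age.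

Let v select an on channel whenever there is one, and B = V(v)P. Every product in the definition of
λ'_L dominates B^L entrywise, so monotonicity of the spectral radius on nonnegative matrices gives
λ'_L = ρ(B) for L ≥ 1.

If ρ_max² ρ(B) < 1, serve the oldest sensor through v. With r slightly above ρ_max² (when ρ_max ≥
1), a vector y satisfying rBy ≤ y - 1/2, and a discount θ for each fresher sensor, r^φ θ^rank y(h)
is a Lyapunov function (`IsModel.exists_integral_pow_aoi_le`).

If R ρ(B) ≥ 1 with R = ρ_max², take y ≥ 0 nonzero with y ≤ RBy. Under every policy E[R^φ y(h)] is
nondecreasing: y vanishes where some channel is on, and elsewhere no packet gets through. To include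
equality, y is chosen so that each visit to a certain on state adds a fixed amount
(`Channel.exists_subinvariant_charged`). Irreducibility makes the expected number of visits
infinite, so the error diverges. If no channel is ever on, the age is t and divergence is direct. -/

namespace RemoteEstimation

/-! ### Spectral radius of nonnegative matrices through the growth of powers. -/

section SpectralRadius

open scoped Matrix.Norms.Operator Topology

theorem mulVec_nonneg_of_nonneg {ι : Type*} [Fintype ι] {A : Matrix ι ι ℝ}
    (hA : ∀ i j, 0 ≤ A i j) {y : ι → ℝ} (hy : ∀ i, 0 ≤ y i) (i : ι) : 0 ≤ (A *ᵥ y) i :=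
  Finset.sum_nonneg fun j _ => mul_nonneg (hA i j) (hy j)

theorem mulVec_mono_of_nonneg {ι : Type*} [Fintype ι] {A : Matrix ι ι ℝ}
    (hA : ∀ i j, 0 ≤ A i j) {y z : ι → ℝ} (hy : ∀ i, y i ≤ z i) (i : ι) : (A *ᵥ y) i ≤ (A *ᵥ z) i :=
  Finset.sum_le_sum fun j _ => mul_le_mul_of_nonneg_left (hy j) (hA i j)

variable {ι : Type*} [Fintype ι] [DecidableEq ι]

theorem norm_entry_le_linftyOp (A : Matrix ι ι ℂ) (i j : ι) : ‖A i j‖ ≤ ‖A‖ := by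
  have h1 : ‖A i j‖₊ ≤ ∑ j, ‖A i j‖₊ :=
    Finset.single_le_sum (f := fun j => ‖A i j‖₊) (fun _ _ => zero_le) (Finset.mem_univ j)
  have h2 : ∑ j, ‖A i j‖₊ ≤ Finset.univ.sup fun i => ∑ j, ‖A i j‖₊ :=
    Finset.le_sup (f := fun i => ∑ j, ‖A i j‖₊) (Finset.mem_univ i)
  rw [Matrix.linfty_opNorm_def]
  exact_mod_cast h1.trans h2

theorem linftyOp_norm_le_card_mul {A : Matrix ι ι ℂ} {b : ℝ} (hb : 0 ≤ b)
    (h : ∀ i j, ‖A i j‖ ≤ b) : ‖A‖ ≤ Fintype.card ι * b := by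
  lift b to NNReal using hb
  rw [Matrix.linfty_opNorm_def]
  have : (Finset.univ.sup fun i => ∑ j, ‖A i j‖₊) ≤ Fintype.card ι * b := by
    refine Finset.sup_le fun i _ => ?_
    refine (Finset.sum_le_card_nsmul _ _ b fun j _ => h i j).trans ?_
    simp
  exact_mod_cast this

theorem specRad_nonneg (A : Matrix ι ι ℝ) : 0 ≤ specRad A := ENNReal.toReal_nonneg

theorem specRad_of_isEmpty [IsEmpty ι] (A : Matrix ι ι ℝ) : specRad A = 0 := by
  simp [specRad, spectralRadius, spectrum.of_subsingleton]

theorem spectralRadius_ne_top (A : Matrix ι ι ℂ) : spectralRadius ℂ A ≠ ∞ := by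
  cases isEmpty_or_nonempty ι
  · simp [spectralRadius, spectrum.of_subsingleton]
  · exact ne_top_of_le_ne_top ENNReal.coe_ne_top (spectrum.spectralRadius_le_nnnorm A)

theorem map_ofReal_pow (A : Matrix ι ι ℝ) (k : ℕ) :
    (A ^ k).map ((↑) : ℝ → ℂ) = (A.map ((↑) : ℝ → ℂ)) ^ k :=
  map_pow (Complex.ofRealHom.mapMatrix (m := ι)) A k

theorem specRad_pow_le_norm (A : Matrix ι ι ℝ) {k : ℕ} (hk : k ≠ 0) :
    specRad A ^ k ≤ ‖(A ^ k).map ((↑) : ℝ → ℂ)‖ := by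
  cases isEmpty_or_nonempty ι
  · simp [specRad_of_isEmpty, hk]
  · have h := (spectrum.spectralRadius_pow_le (𝕜 := ℂ) (A.map ((↑) : ℝ → ℂ)) k hk).trans
      (spectrum.spectralRadius_le_nnnorm _)
    rw [specRad, ← ENNReal.toReal_pow, map_ofReal_pow]
    exact ENNReal.toReal_mono ENNReal.coe_ne_top h

theorem specRad_pow_le_card_mul (A : Matrix ι ι ℝ) {k : ℕ} (hk : k ≠ 0) {b : ℝ} (hb : 0 ≤ b)
    (h : ∀ i j, |(A ^ k) i j| ≤ b) : specRad A ^ k ≤ Fintype.card ι * b :=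
  (specRad_pow_le_norm A hk).trans (linftyOp_norm_le_card_mul hb fun i j => by simpa using h i j)

/-- Entries of the powers of `A` grow no faster than `s ^ k` for any `s` above the spectral
radius. -/
theorem exists_abs_pow_apply_le {A : Matrix ι ι ℝ} {s : ℝ} (hs : specRad A < s) :
    ∃ C, 0 ≤ C ∧ ∀ k i j, |(A ^ k) i j| ≤ C * s ^ k := by
  set a : Matrix ι ι ℂ := A.map ((↑) : ℝ → ℂ) with ha
  have hs0 : 0 < s := (specRad_nonneg A).trans_lt hs
  have hlt : spectralRadius ℂ a < ENNReal.ofReal s := by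
    rw [← ENNReal.ofReal_toReal (spectralRadius_ne_top a)]
    exact (ENNReal.ofReal_lt_ofReal_iff hs0).2 hs
  obtain ⟨n, hn⟩ := eventually_atTop.1 <|
    ((spectrum.pow_norm_pow_one_div_tendsto_nhds_spectralRadius a).eventually_lt_const hlt).and
      (eventually_ge_atTop 1)
  have hbig : ∀ k, n ≤ k → ‖a ^ k‖ ≤ s ^ k := by
    intro k hk
    obtain ⟨h1, h2⟩ := hn k hk
    have h3 := ((ENNReal.ofReal_lt_ofReal_iff hs0).1 h1).le
    have h4 := pow_le_pow_left₀ (by positivity) h3 k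
    rwa [one_div, Real.rpow_inv_natCast_pow (norm_nonneg _) (by omega)] at h4
  -- Gelfand's formula gives the bound from `n` on; the sum absorbs the finitely many earlier
  -- powers.
  refine ⟨1 + ∑ k ∈ Finset.range n, ‖a ^ k‖ / s ^ k, add_nonneg zero_le_one
    (Finset.sum_nonneg fun k _ => div_nonneg (norm_nonneg _) (pow_nonneg hs0.le k)),
    fun k i j => ?_⟩
  have h1 : |(A ^ k) i j| ≤ ‖a ^ k‖ := by
    rw [ha, ← map_ofReal_pow]
    simpa using norm_entry_le_linftyOp ((A ^ k).map ((↑) : ℝ → ℂ)) i j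
  refine h1.trans ?_
  have h0 : (0 : ℝ) ≤ ∑ k ∈ Finset.range n, ‖a ^ k‖ / s ^ k :=
    Finset.sum_nonneg fun k _ => div_nonneg (norm_nonneg _) (pow_nonneg hs0.le k)
  rcases le_or_gt n k with hk | hk
  · exact (hbig k hk).trans (le_mul_of_one_le_left (by positivity) (by linarith))
  · rw [← div_le_iff₀ (by positivity)]
    have := Finset.single_le_sum (f := fun k => ‖a ^ k‖ / s ^ k)
      (fun k _ => div_nonneg (norm_nonneg _) (pow_nonneg hs0.le k))
      (Finset.mem_range.2 hk)
    linarith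

/-- Otherwise the powers of `specRad A / s` would be unbounded, although `specRad A ^ k` is at most
a norm of `A ^ k`. With `exists_abs_pow_apply_le` this characterises `specRad` by entry growth, from
which monotonicity and the rules for powers and scalars follow. -/
theorem specRad_le_of_abs_pow_apply_le {A : Matrix ι ι ℝ} {s C : ℝ} (hs : 0 ≤ s)
    (h : ∀ k i j, |(A ^ k) i j| ≤ C * s ^ k) : specRad A ≤ s := by
  cases isEmpty_or_nonempty ι
  · simpa [specRad_of_isEmpty] using hs
  have hC : 0 ≤ C := by
    obtain ⟨i⟩ := ‹Nonempty ι›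
    simpa using (abs_nonneg _).trans (h 0 i i)
  have hk : ∀ k, k ≠ 0 → specRad A ^ k ≤ (Fintype.card ι * C) * s ^ k := fun k hk => by
    rw [mul_assoc]
    exact specRad_pow_le_card_mul A hk (by positivity) (h k)
  by_contra! hlt
  rcases hs.eq_or_lt with rfl | hs'
  · have := hk 1 one_ne_zero
    simp at this
    linarith
  · have h1 : 1 < specRad A / s := (one_lt_div hs').2 hlt
    obtain ⟨n, hn⟩ := pow_unbounded_of_one_lt (Fintype.card ι * C) h1
    have h2 := hk (n + 1) n.succ_ne_zero
    rw [← div_le_iff₀ (by positivity), ← div_pow] at h2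
    exact absurd (hn.trans_le ((pow_le_pow_right₀ h1.le n.le_succ).trans h2)) (lt_irrefl _)

theorem pow_apply_nonneg {A : Matrix ι ι ℝ} (hA : ∀ i j, 0 ≤ A i j) (k : ℕ) (i j : ι) :
    0 ≤ (A ^ k) i j := by
  induction k generalizing i j with
  | zero => simp only [pow_zero, Matrix.one_apply]; split_ifs <;> simp
  | succ k ih =>
    rw [pow_succ, Matrix.mul_apply]
    exact Finset.sum_nonneg fun l _ => mul_nonneg (ih i l) (hA l j)

theorem pow_apply_le_pow_apply {A B : Matrix ι ι ℝ} (hA : ∀ i j, 0 ≤ A i j)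
    (hAB : ∀ i j, A i j ≤ B i j) (k : ℕ) (i j : ι) : (A ^ k) i j ≤ (B ^ k) i j := by
  induction k generalizing i j with
  | zero => simp
  | succ k ih =>
    rw [pow_succ, Matrix.mul_apply, pow_succ, Matrix.mul_apply]
    exact Finset.sum_le_sum fun l _ => mul_le_mul (ih i l) (hAB l j) (hA l j)
      ((pow_apply_nonneg hA k i l).trans (ih i l))

/-- The spectral radius is monotone on entrywise nonnegative matrices. -/
theorem specRad_mono {A B : Matrix ι ι ℝ} (hA : ∀ i j, 0 ≤ A i j) (hAB : ∀ i j, A i j ≤ B i j) :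
    specRad A ≤ specRad B := by
  refine le_of_forall_gt_imp_ge_of_dense fun s hs => ?_
  obtain ⟨C, -, hC⟩ := exists_abs_pow_apply_le hs
  refine specRad_le_of_abs_pow_apply_le (C := C) ((specRad_nonneg B).trans hs.le) fun k i j => ?_
  rw [abs_of_nonneg (pow_apply_nonneg hA k i j)]
  exact (pow_apply_le_pow_apply hA hAB k i j).trans ((le_abs_self _).trans (hC k i j))

theorem specRad_pow (A : Matrix ι ι ℝ) {k : ℕ} (hk : k ≠ 0) :
    specRad (A ^ k) = specRad A ^ k := by
  apply le_antisymm
  · have hc : ContinuousWithinAt (fun s : ℝ => s ^ k) (Set.Ioi (specRad A)) (specRad A) := by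
      fun_prop
    refine ge_of_tendsto hc.tendsto ?_
    filter_upwards [self_mem_nhdsWithin] with s hs
    obtain ⟨C, -, hC⟩ := exists_abs_pow_apply_le (A := A) hs
    have hs0 : 0 ≤ s := (specRad_nonneg A).trans (le_of_lt hs)
    refine specRad_le_of_abs_pow_apply_le (C := C) (by positivity) fun m i j => ?_
    rw [← pow_mul, ← pow_mul]
    exact hC _ i j
  · rw [specRad, specRad, ← ENNReal.toReal_pow, map_ofReal_pow]
    exact ENNReal.toReal_mono (spectralRadius_ne_top _) (spectrum.spectralRadius_pow_le _ k hk)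

/-- A row (sub)stochastic matrix has spectral radius at most `1`. -/
theorem specRad_le_one {A : Matrix ι ι ℝ} (hA : ∀ i j, 0 ≤ A i j) (h1 : ∀ i, ∑ j, A i j ≤ 1) :
    specRad A ≤ 1 := by
  have hrow : ∀ k i, ∑ j, (A ^ k) i j ≤ 1 := by
    intro k
    induction k with
    | zero => intro i; simp [Matrix.one_apply]
    | succ k ih =>
      intro i
      simp only [pow_succ, Matrix.mul_apply]
      rw [Finset.sum_comm]
      simp only [← Finset.mul_sum]
      refine le_trans (Finset.sum_le_sum fun l _ => ?_) (ih i)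
      exact mul_le_of_le_one_right (pow_apply_nonneg hA k i l) (h1 l)
  refine specRad_le_of_abs_pow_apply_le (C := 1) zero_le_one fun k i j => ?_
  rw [abs_of_nonneg (pow_apply_nonneg hA k i j), one_pow, one_mul]
  exact (Finset.single_le_sum (f := fun j => (A ^ k) i j)
    (fun j _ => pow_apply_nonneg hA k i j) (Finset.mem_univ j)).trans (hrow k i)

/-- Truncated resolvent `∑_{k<m} B^k 1`. -/
def resolventVec (B : Matrix ι ι ℝ) (m : ℕ) : ι → ℝ :=
  ∑ k ∈ Finset.range m, (B ^ k) *ᵥ 1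

/-- Telescoping. The truncation replaces `(1 - B)⁻¹ 1` whether or not the Neumann series converges;
the remainder `B ^ m 1` is small in one application and discarded by its sign in the other. -/
theorem mulVec_resolventVec (B : Matrix ι ι ℝ) (m : ℕ) :
    B *ᵥ resolventVec B m + 1 = resolventVec B m + (B ^ m) *ᵥ 1 := by
  have h1 : B *ᵥ resolventVec B m = ∑ k ∈ Finset.range m, (B ^ (k + 1)) *ᵥ 1 := by
    rw [resolventVec, Matrix.mulVec_sum]
    refine Finset.sum_congr rfl fun k _ => ?_
    rw [Matrix.mulVec_mulVec, pow_succ']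
  have h2 := Finset.sum_range_succ (fun k => (B ^ k) *ᵥ (1 : ι → ℝ)) m
  have h3 := Finset.sum_range_succ' (fun k => (B ^ k) *ᵥ (1 : ι → ℝ)) m
  rw [h1, resolventVec, ← h2, h3]
  simp

theorem specRad_smul {r : ℝ} (hr : 0 ≤ r) (A : Matrix ι ι ℝ) :
    specRad (r • A) = r * specRad A := by
  have key : ∀ {r : ℝ}, 0 ≤ r → ∀ A : Matrix ι ι ℝ, specRad (r • A) ≤ r * specRad A := by
    intro r hr A
    have hc : ContinuousWithinAt (fun s : ℝ => r * s) (Set.Ioi (specRad A)) (specRad A) := by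
      fun_prop
    refine ge_of_tendsto hc.tendsto ?_
    filter_upwards [self_mem_nhdsWithin] with s hs
    obtain ⟨C, -, hC⟩ := exists_abs_pow_apply_le (A := A) hs
    have hs0 : 0 ≤ s := (specRad_nonneg A).trans (le_of_lt hs)
    refine specRad_le_of_abs_pow_apply_le (C := C) (by positivity) fun m i j => ?_
    rw [smul_pow, Matrix.smul_apply, smul_eq_mul, abs_mul, abs_of_nonneg (by positivity), mul_pow,
      mul_left_comm]
    exact mul_le_mul_of_nonneg_left (hC m i j) (by positivity)
  refine le_antisymm (key hr A) ?_
  rcases hr.eq_or_lt with rfl | h0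
  · simpa using specRad_nonneg _
  · have := key (inv_nonneg.2 hr) (r • A)
    rw [smul_smul, inv_mul_cancel₀ h0.ne', one_smul] at this
    rwa [le_inv_mul_iff₀ h0] at this

/-- A contracting weight vector for a nonnegative matrix with spectral radius below `1`. -/
theorem exists_mulVec_le_sub_half {B : Matrix ι ι ℝ} (hB : ∀ i j, 0 ≤ B i j)
    (h : specRad B < 1) : ∃ y : ι → ℝ, (∀ i, 1 ≤ y i) ∧ ∀ i, (B *ᵥ y) i ≤ y i - 1 / 2 := by
  obtain ⟨s, hs, hs1⟩ := exists_between h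
  have hs0 : 0 ≤ s := (specRad_nonneg B).trans hs.le
  obtain ⟨C, hC0, hC⟩ := exists_abs_pow_apply_le hs
  have ht : Tendsto (fun m : ℕ => Fintype.card ι * C * s ^ m) atTop (𝓝 (Fintype.card ι * C * 0)) :=
    (tendsto_pow_atTop_nhds_zero_of_lt_one hs0 hs1).const_mul _
  rw [mul_zero] at ht
  obtain ⟨m, hm, hm1⟩ := ((ht.eventually_lt_const (show (0 : ℝ) < 1 / 2 by norm_num)).and
    (eventually_ge_atTop 1)).exists
  -- Here `B ^ m 1` is below `1 / 2`, so `B y = y + B ^ m 1 - 1` gives the claim; the term `k = 0`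
  -- gives `1 ≤ y`.
  refine ⟨resolventVec B m, fun i => ?_, fun i => ?_⟩
  · rw [resolventVec, Finset.sum_apply]
    have := Finset.single_le_sum (f := fun k => ((B ^ k) *ᵥ (1 : ι → ℝ)) i)
      (fun k _ => mulVec_nonneg_of_nonneg (pow_apply_nonneg hB k) (fun _ => zero_le_one) i)
      (Finset.mem_range.2 (show 0 < m by omega))
    simpa using this
  · have h1 := congrFun (mulVec_resolventVec B m) i
    simp only [Pi.add_apply, Pi.one_apply] at h1
    have h2 : ((B ^ m) *ᵥ (1 : ι → ℝ)) i ≤ Fintype.card ι * C * s ^ m := by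
      simp only [Matrix.mulVec, dotProduct, Pi.one_apply, mul_one]
      refine (Finset.sum_le_card_nsmul _ _ (C * s ^ m)
        fun j _ => (le_abs_self _).trans (hC m i j)).trans ?_
      simp [mul_assoc]
    linarith

/-- A nonnegative matrix with spectral radius at least `1` has a nonzero nonnegative subinvariant
vector. -/
theorem exists_le_mulVec {B : Matrix ι ι ℝ} (hB : ∀ i j, 0 ≤ B i j)
    (h : 1 ≤ specRad B) : ∃ y : ι → ℝ, (∀ i, 0 ≤ y i) ∧ (∃ i, 0 < y i) ∧
      ∀ i, y i ≤ (B *ᵥ y) i := by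
  have hnn : ∀ m i, 0 ≤ resolventVec B m i := fun m i => by
    rw [resolventVec, Finset.sum_apply]
    exact Finset.sum_nonneg fun k _ =>
      mulVec_nonneg_of_nonneg (pow_apply_nonneg hB k) (fun _ => zero_le_one) i
  set S : ℕ → ℝ := fun m => ∑ i, resolventVec B m i with hS
  have hSsucc : ∀ m, S (m + 1) = S m + ∑ i, ((B ^ m) *ᵥ (1 : ι → ℝ)) i := fun m => by
    simp only [hS, resolventVec, Finset.sum_range_succ, Pi.add_apply, Finset.sum_add_distrib]
  have hSmono : Monotone S := monotone_nat_of_le_succ fun m => by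
    rw [hSsucc]
    have : 0 ≤ ∑ i, ((B ^ m) *ᵥ (1 : ι → ℝ)) i := Finset.sum_nonneg fun i _ =>
      mulVec_nonneg_of_nonneg (pow_apply_nonneg hB m) (fun _ => zero_le_one) i
    linarith
  -- The increment is the sum of the entries of `B ^ m`, which cannot fall below `1 / card ι` when
  -- the spectral radius is at least `1`. Hence `S` diverges.
  have hSinc : ∀ m, m ≠ 0 → 1 ≤ Fintype.card ι * (S (m + 1) - S m) := by
    intro m hm
    rw [hSsucc, add_sub_cancel_left]
    refine (one_le_pow₀ h).trans (specRad_pow_le_card_mul B hm ?_ fun i j => ?_)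
    · exact Finset.sum_nonneg fun i _ =>
        mulVec_nonneg_of_nonneg (pow_apply_nonneg hB m) (fun _ => zero_le_one) i
    · rw [abs_of_nonneg (pow_apply_nonneg hB m i j)]
      have h1 : (B ^ m) i j ≤ ((B ^ m) *ᵥ (1 : ι → ℝ)) i := by
        simp only [Matrix.mulVec, dotProduct, Pi.one_apply, mul_one]
        exact Finset.single_le_sum (f := fun j => (B ^ m) i j)
          (fun j _ => pow_apply_nonneg hB m i j) (Finset.mem_univ j)
      exact h1.trans (Finset.single_le_sum (f := fun i => ((B ^ m) *ᵥ (1 : ι → ℝ)) i)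
        (fun i _ => mulVec_nonneg_of_nonneg (pow_apply_nonneg hB m) (fun _ => zero_le_one) i)
        (Finset.mem_univ i))
  have hStop : Tendsto S atTop atTop := by
    rcases tendsto_atTop_of_monotone hSmono with ht | ⟨l, hl⟩
    · exact ht
    · exfalso
      have h1 : Tendsto (fun m => Fintype.card ι * (S (m + 1) - S m)) atTop
          (𝓝 (Fintype.card ι * (l - l))) :=
        (((tendsto_add_atTop_iff_nat 1).2 hl).sub hl).const_mul _
      have h2 := ge_of_tendsto h1 (eventually_atTop.2 ⟨1, fun m hm => hSinc m (by omega)⟩)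
      norm_num at h2
  -- The normalised truncations satisfy `u ≤ B u + 1 / S`; a limit point in the compact simplex is
  -- nonzero and loses the error term.
  set u : ℕ → ι → ℝ := fun m i => resolventVec B m i / S m
  have hu : ∀ᶠ m in atTop, u m ∈ stdSimplex ℝ ι := by
    filter_upwards [hStop.eventually_gt_atTop 0] with m hm
    refine ⟨fun i => div_nonneg (hnn m i) hm.le, ?_⟩
    simp only [u]
    rw [← Finset.sum_div, div_self hm.ne']
  obtain ⟨y, hy, φ, hφ, hlim⟩ := (isCompact_stdSimplex ℝ ι).tendsto_subseq' hu.frequently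
  refine ⟨y, hy.1, ?_, fun i => ?_⟩
  · by_contra! hcon
    have : ∑ i, y i ≤ 0 := Finset.sum_nonpos fun i _ => hcon i
    linarith [hy.2]
  · have h1 : Tendsto (fun k => u (φ k) i) atTop (𝓝 (y i)) :=
      (continuous_apply i).continuousAt.tendsto.comp hlim
    have h2 : Tendsto (fun k => (B *ᵥ u (φ k)) i) atTop (𝓝 ((B *ᵥ y) i)) :=
      ((continuous_apply i).comp (Continuous.matrix_mulVec continuous_const
        continuous_id)).continuousAt.tendsto.comp hlim
    have h3 : Tendsto (fun k => 1 / S (φ k)) atTop (𝓝 0) := by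
      simp only [one_div]
      exact tendsto_inv_atTop_zero.comp (hStop.comp hφ.tendsto_atTop)
    have h4 := h2.add h3
    rw [add_zero] at h4
    refine le_of_tendsto_of_tendsto h1 h4 ?_
    filter_upwards [(hStop.comp hφ.tendsto_atTop).eventually_gt_atTop 0] with k hk
    have hk' : 0 < S (φ k) := hk
    have e1 : (B *ᵥ u (φ k)) i = (B *ᵥ resolventVec B (φ k)) i / S (φ k) := by
      simp only [Matrix.mulVec, dotProduct, u, Finset.sum_div, mul_div_assoc]
    rw [e1, ← add_div]
    refine div_le_div_of_nonneg_right ?_ hk'.le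
    have h5 := congrFun (mulVec_resolventVec B (φ k)) i
    simp only [Pi.add_apply, Pi.one_apply] at h5
    have h6 : 0 ≤ ((B ^ (φ k)) *ᵥ (1 : ι → ℝ)) i :=
      mulVec_nonneg_of_nonneg (pow_apply_nonneg hB _) (fun _ => zero_le_one) i
    linarith

end SpectralRadius

/-! ### Optimal channel selection and the rates `λ'_L`. -/

namespace Channel

variable {M K : ℕ} (c : Channel M K)

theorem failure_mul_apply (v : Fin K → Fin M) (i j : Fin K) :
    (c.failure v * c.P) i j = if c.on i (v i) then 0 else c.P i j := by
  rw [failure, Matrix.diagonal_mul]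
  split_ifs <;> simp

theorem failure_mul_nonneg {c : Channel M K} (hP : ∀ i j, 0 ≤ c.P i j) (v : Fin K → Fin M)
    (i j : Fin K) : 0 ≤ (c.failure v * c.P) i j := by
  rw [failure_mul_apply]
  split_ifs
  exacts [le_rfl, hP i j]

theorem specRad_failure_mul_le_one {c : Channel M K}
    (hP : c.P ∈ Matrix.rowStochastic ℝ (Fin K)) (v : Fin K → Fin M) :
    specRad (c.failure v * c.P) ≤ 1 := by
  obtain ⟨h0, h1⟩ := Matrix.mem_rowStochastic_iff_sum.1 hP
  refine specRad_le_one (failure_mul_nonneg h0 v) fun i => ?_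
  simp only [failure_mul_apply]
  split_ifs
  · simp
  · exact (h1 i).le

/-- A channel selection is optimal if it picks an on channel whenever there is one. -/
theorem exists_failure_le (hM : 1 ≤ M) :
    ∃ v : Fin K → Fin M, ∀ v' i j, c.failure v i j ≤ c.failure v' i j := by
  have h : ∀ i, ∃ m : Fin M, ∀ m', c.on i m' = true → c.on i m = true := by
    intro i
    by_cases hi : ∃ m, c.on i m = true
    · exact ⟨hi.choose, fun _ _ => hi.choose_spec⟩
    · exact ⟨⟨0, hM⟩, fun m' hm' => absurd ⟨m', hm'⟩ hi⟩
  choose v hv using h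
  refine ⟨v, fun v' i j => ?_⟩
  simp only [failure, Matrix.diagonal_apply]
  split_ifs with h1 h2 h3 h3 <;> simp_all
  exact absurd (hv _ _ h3) (by simp [h2])

theorem on_of_failure_le {c : Channel M K} {v : Fin K → Fin M}
    (hv : ∀ v' i j, c.failure v i j ≤ c.failure v' i j) {i : Fin K} {m : Fin M}
    (hm : c.on i m = true) : c.on i (v i) = true := by
  by_contra h
  have := hv (fun _ => m) i i
  simp [failure, hm, h] at this
  linarith

/-- All factors are nonnegative and each one dominates `c.failure v * c.P`, so the comparison passes
through the product. -/
theorem pow_failure_mul_le_prod {c : Channel M K} (hP : ∀ i j, 0 ≤ c.P i j) {v : Fin K → Fin M}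
    (hv : ∀ v' i j, c.failure v i j ≤ c.failure v' i j) (L : ℕ) (u : Fin L → Fin K → Fin M)
    (i j : Fin K) :
    ((c.failure v * c.P) ^ L) i j ≤ (List.ofFn fun k => c.failure (u k) * c.P).prod i j := by
  induction L generalizing i j with
  | zero => simp
  | succ L ih =>
    rw [List.ofFn_succ, List.prod_cons, pow_succ', Matrix.mul_apply, Matrix.mul_apply]
    refine Finset.sum_le_sum fun l _ => mul_le_mul ?_ (ih _ _ _)
      (pow_apply_nonneg (failure_mul_nonneg hP v) _ _ _) (failure_mul_nonneg hP _ _ _)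
    rw [failure, failure, Matrix.diagonal_mul, Matrix.diagonal_mul]
    refine mul_le_mul_of_nonneg_right ?_ (hP _ _)
    simpa [failure] using hv (u 0) i i

theorem prodRate_const {v : Fin K → Fin M} {L : ℕ} (hL : 1 ≤ L) :
    c.prodRate L (fun _ => v) = specRad (c.failure v * c.P) := by
  rw [prodRate, List.ofFn_const, List.prod_replicate, specRad_pow _ (by omega), one_div,
    Real.pow_rpow_inv_natCast (specRad_nonneg _) (by omega)]

theorem rate_eq_prodRate {c : Channel M K} (hP : ∀ i j, 0 ≤ c.P i j) {v : Fin K → Fin M}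
    (hv : ∀ v' i j, c.failure v i j ≤ c.failure v' i j) (L : ℕ) :
    c.rate L = c.prodRate L (fun _ => v) := by
  have : Nonempty (Fin L → Fin K → Fin M) := ⟨fun _ => v⟩
  refine le_antisymm (ciInf_le (Set.finite_range _).bddBelow _) (le_ciInf fun u => ?_)
  refine Real.rpow_le_rpow (specRad_nonneg _) ?_ (by positivity)
  rw [List.ofFn_const, List.prod_replicate]
  exact specRad_mono (pow_apply_nonneg (failure_mul_nonneg hP v) L)
    (pow_failure_mul_le_prod hP hv L u)

theorem rate_eq_specRad {c : Channel M K} (hP : ∀ i j, 0 ≤ c.P i j) {v : Fin K → Fin M}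
    (hv : ∀ v' i j, c.failure v i j ≤ c.failure v' i j) {L : ℕ} (hL : 1 ≤ L) :
    c.rate L = specRad (c.failure v * c.P) := by
  rw [rate_eq_prodRate hP hv, prodRate_const c hL]

theorem rateInf_eq_specRad {c : Channel M K} (hP : ∀ i j, 0 ≤ c.P i j) {v : Fin K → Fin M}
    (hv : ∀ v' i j, c.failure v i j ≤ c.failure v' i j) :
    c.rateInf = specRad (c.failure v * c.P) := by
  refine Tendsto.liminf_eq (tendsto_const_nhds.congr' ?_)
  -- At `L = 0` the exponent `1 / 0` is `0` and the rate is `1`; the sequence is constant only from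
  -- `L = 1`.
  filter_upwards [eventually_ge_atTop 1] with L hL
  exact (rate_eq_specRad hP hv hL).symm

end Channel

/-! ### Quadratic forms at complex vectors, written over the reals. -/

section QuadraticForm

variable {ι : Type*} [Fintype ι]

/-- A quadratic form of a positive semidefinite matrix is bounded by its trace. -/
theorem dotProduct_mulVec_le_trace {G : Matrix ι ι ℝ} (hG : G.PosSemidef) (x : ι → ℝ) :
    x ⬝ᵥ (G *ᵥ x) ≤ (x ⬝ᵥ x) * G.trace := by
  classical
  open scoped MatrixOrder Matrix.Norms.L2Operator in
  -- With `G = Bᴴ B` the form is `‖B x‖²` and the trace is the sum of the squared entries of `B`;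
  -- Cauchy–Schwarz applies row by row.
  obtain ⟨B, hB⟩ := CStarAlgebra.nonneg_iff_eq_star_mul_self.mp hG.nonneg
  rw [Matrix.star_eq_conjTranspose] at hB
  subst hB
  have h1 : x ⬝ᵥ ((Bᴴ * B) *ᵥ x) = ∑ k, (∑ j, B k j * x j) ^ 2 := by
    rw [← Matrix.mulVec_mulVec, Matrix.conjTranspose_eq_transpose_of_trivial,
      Matrix.dotProduct_mulVec, Matrix.vecMul_transpose]
    simp only [dotProduct, Matrix.mulVec, sq]
  have h2 : (Bᴴ * B).trace = ∑ k, ∑ j, B k j ^ 2 := by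
    simp only [Matrix.trace, Matrix.diag_apply, Matrix.mul_apply, Matrix.conjTranspose_apply,
      star_trivial, sq]
    exact Finset.sum_comm
  have h3 : x ⬝ᵥ x = ∑ j, x j ^ 2 := by simp only [dotProduct, sq]
  rw [h1, h2, h3, Finset.mul_sum]
  refine Finset.sum_le_sum fun k _ => ?_
  rw [mul_comm]
  exact Finset.sum_mul_sq_le_sq_mul_sq _ _ _

/-- The Hermitian form `u^* G u` of a real symmetric matrix at `u = x + i y`. -/
def pairForm (G : Matrix ι ι ℝ) (x y : ι → ℝ) : ℝ := x ⬝ᵥ (G *ᵥ x) + y ⬝ᵥ (G *ᵥ y)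

theorem pairForm_nonneg {G : Matrix ι ι ℝ} (hG : G.PosSemidef) (x y : ι → ℝ) :
    0 ≤ pairForm G x y := by
  have h := fun z => hG.dotProduct_mulVec_nonneg z
  simp only [star_trivial] at h
  exact add_nonneg (h x) (h y)

theorem pairForm_add (G H : Matrix ι ι ℝ) (x y : ι → ℝ) :
    pairForm (G + H) x y = pairForm G x y + pairForm H x y := by
  simp only [pairForm, Matrix.add_mulVec, dotProduct_add]
  ring

theorem pairForm_conj {κ : Type*} [Fintype κ] (B : Matrix ι κ ℝ) (G : Matrix κ κ ℝ)
    (x y : ι → ℝ) : pairForm (B * G * Bᵀ) x y = pairForm G (Bᵀ *ᵥ x) (Bᵀ *ᵥ y) := by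
  have h : ∀ z, z ⬝ᵥ ((B * G * Bᵀ) *ᵥ z) = (Bᵀ *ᵥ z) ⬝ᵥ (G *ᵥ (Bᵀ *ᵥ z)) := fun z => by
    rw [← Matrix.mulVec_mulVec, ← Matrix.mulVec_mulVec, Matrix.dotProduct_mulVec,
      ← Matrix.mulVec_transpose]
  simp only [pairForm, h]

/-- This is multiplication of `x + i y` by the scalar `a + i b`: the cross terms cancel and the
squared modulus factors out. -/
theorem pairForm_rotate {G : Matrix ι ι ℝ} (x y : ι → ℝ) (a b : ℝ) :
    pairForm G (a • x - b • y) (b • x + a • y) = (a ^ 2 + b ^ 2) * pairForm G x y := by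
  simp only [pairForm, Matrix.mulVec_sub, Matrix.mulVec_add, Matrix.mulVec_smul,
    sub_dotProduct, add_dotProduct, dotProduct_sub, dotProduct_add, smul_dotProduct,
    dotProduct_smul, smul_eq_mul]
  ring

theorem mulVec_eq_zero_of_pairForm_eq_zero {G : Matrix ι ι ℝ} (hG : G.PosSemidef) {x y : ι → ℝ}
    (h : pairForm G x y = 0) : G *ᵥ x = 0 ∧ G *ᵥ y = 0 := by
  have h0 := fun z => hG.dotProduct_mulVec_nonneg z
  simp only [star_trivial] at h0
  have hx := h0 x
  have hy := h0 y
  rw [pairForm] at h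
  have h1 := fun z => (hG.dotProduct_mulVec_zero_iff z).1
  simp only [star_trivial] at h1
  exact ⟨h1 x (by linarith), h1 y (by linarith)⟩

theorem eq_zero_of_pairForm_eq_zero {G : Matrix ι ι ℝ} (hG : G.PosDef) {x y : ι → ℝ}
    (h : pairForm G x y = 0) : x = 0 ∧ y = 0 := by
  classical
  obtain ⟨hx, hy⟩ := mulVec_eq_zero_of_pairForm_eq_zero hG.posSemidef h
  have hi := Matrix.mulVec_injective_of_isUnit hG.isUnit
  exact ⟨hi (by simpa using hx), hi (by simpa using hy)⟩

end QuadraticForm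

/-! ### Dominant modes in real form. -/

section Eigenvector

variable {ι : Type*} [Fintype ι] [DecidableEq ι]

/-- Real form of a left eigenvector for an eigenvalue `a + i b` of maximal modulus. -/
theorem exists_left_eigenvector_of_specRad_pos {A : Matrix ι ι ℝ} (hA : 0 < specRad A) :
    ∃ a b : ℝ, ∃ x y : ι → ℝ, a ^ 2 + b ^ 2 = specRad A ^ 2 ∧ ¬ (x = 0 ∧ y = 0) ∧
      Aᵀ *ᵥ x = a • x - b • y ∧ Aᵀ *ᵥ y = b • x + a • y := by
  classical
  cases isEmpty_or_nonempty ι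
  · rw [specRad_of_isEmpty] at hA
    exact absurd hA (lt_irrefl _)
  open scoped Matrix.Norms.Operator in
  obtain ⟨z, hz, hzr⟩ := spectrum.exists_nnnorm_eq_spectralRadius (A.map ((↑) : ℝ → ℂ))
  have hdet : (algebraMap ℂ (Matrix ι ι ℂ) z - A.map ((↑) : ℝ → ℂ)).det = 0 := by
    rw [spectrum.mem_iff, Matrix.isUnit_iff_isUnit_det, isUnit_iff_ne_zero, not_not] at hz
    exact hz
  obtain ⟨v, hv, hvz⟩ := Matrix.exists_vecMul_eq_zero_iff.2 hdet
  have hv' : v ᵥ* A.map ((↑) : ℝ → ℂ) = z • v := by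
    rw [Matrix.vecMul_sub, sub_eq_zero, Algebra.algebraMap_eq_smul_one, Matrix.vecMul_smul,
      Matrix.vecMul_one] at hvz
    exact hvz.symm
  have hj : ∀ j, ∑ i, v i * (A i j : ℂ) = z * v j := fun j => by
    simpa [Matrix.vecMul, dotProduct] using congrFun hv' j
  refine ⟨z.re, z.im, fun i => (v i).re, fun i => (v i).im, ?_, ?_, ?_, ?_⟩
  · rw [specRad, ← hzr]
    simp only [ENNReal.coe_toReal, coe_nnnorm]
    rw [← Complex.normSq_eq_norm_sq, Complex.normSq_apply]
    ring
  · rintro ⟨h1, h2⟩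
    exact hv (funext fun i => Complex.ext (congrFun h1 i) (congrFun h2 i))
  · funext j
    have := congrArg Complex.re (hj j)
    simp only [Complex.re_sum, Complex.mul_re, Complex.ofReal_re, Complex.ofReal_im, mul_zero,
      sub_zero] at this
    simp only [Matrix.mulVec, dotProduct, Matrix.transpose_apply, Pi.sub_apply, Pi.smul_apply,
      smul_eq_mul, ← this]
    exact Finset.sum_congr rfl fun i _ => mul_comm _ _
  · funext j
    have := congrArg Complex.im (hj j)
    simp only [Complex.im_sum, Complex.mul_im, Complex.ofReal_re, Complex.ofReal_im, mul_zero,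
      zero_add] at this
    simp only [Matrix.mulVec, dotProduct, Matrix.transpose_apply, Pi.add_apply, Pi.smul_apply,
      smul_eq_mul]
    rw [add_comm, ← this]
    exact Finset.sum_congr rfl fun i _ => mul_comm _ _

/-- Along the pair, the squared norm under the transposed powers is exactly a multiple of `r ^ (2 *
k)`, while entry growth bounds it by a multiple of `s ^ (2 * k)` for any `s` above the spectral
radius. -/
theorem le_specRad_of_left_eigenvector {A : Matrix ι ι ℝ} {a b r : ℝ} {x y : ι → ℝ}
    (hr : a ^ 2 + b ^ 2 = r ^ 2) (hxy : ¬ (x = 0 ∧ y = 0))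
    (hx : Aᵀ *ᵥ x = a • x - b • y) (hy : Aᵀ *ᵥ y = b • x + a • y) : r ≤ specRad A := by
  refine le_of_forall_gt_imp_ge_of_dense fun s hs => ?_
  by_contra! hlt
  have hs0 : 0 < s := (specRad_nonneg A).trans_lt hs
  obtain ⟨C, hC0, hC⟩ := exists_abs_pow_apply_le hs
  have hpow : ∀ k : ℕ, pairForm 1 ((A ^ k)ᵀ *ᵥ x) ((A ^ k)ᵀ *ᵥ y) =
      (r ^ 2) ^ k * pairForm 1 x y := by
    intro k
    induction k with
    | zero => simp
    | succ k ih =>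
      rw [pow_succ', Matrix.transpose_mul, ← Matrix.mulVec_mulVec, ← Matrix.mulVec_mulVec, hx, hy,
        Matrix.mulVec_sub, Matrix.mulVec_add]
      simp only [Matrix.mulVec_smul]
      rw [pairForm_rotate, ih, hr, pow_succ]
      ring
  have hone : ∀ x y : ι → ℝ, pairForm 1 x y = ∑ i, (x i ^ 2 + y i ^ 2) := fun x y => by
    simp only [pairForm, Matrix.one_mulVec, dotProduct, sq, Finset.sum_add_distrib]
  set m : ℝ := ∑ i, (|x i| + |y i|) with hm
  have hm0 : 0 ≤ m := Finset.sum_nonneg fun i _ => by positivity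
  have hbd : ∀ z : ι → ℝ, (∑ i, |z i|) ≤ m → ∀ (k : ℕ) (i : ι),
      ((A ^ k)ᵀ *ᵥ z) i ^ 2 ≤ (C * m) ^ 2 * (s ^ 2) ^ k := by
    intro z hz k i
    have : |((A ^ k)ᵀ *ᵥ z) i| ≤ C * m * s ^ k := by
      simp only [Matrix.mulVec, dotProduct, Matrix.transpose_apply]
      refine (Finset.abs_sum_le_sum_abs _ _).trans ?_
      calc ∑ j, |(A ^ k) j i * z j| ≤ ∑ j, C * s ^ k * |z j| :=
            Finset.sum_le_sum fun j _ => by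
              rw [abs_mul]; exact mul_le_mul_of_nonneg_right (hC k j i) (abs_nonneg _)
        _ = C * s ^ k * ∑ j, |z j| := by rw [Finset.mul_sum]
        _ ≤ C * s ^ k * m := mul_le_mul_of_nonneg_left hz (by positivity)
        _ = C * m * s ^ k := by ring
    rw [← sq_abs, ← pow_mul, mul_comm 2 k, pow_mul, ← mul_pow]
    exact pow_le_pow_left₀ (abs_nonneg _) this 2
  have hxm : ∑ i, |x i| ≤ m := Finset.sum_le_sum fun i _ => by simp
  have hym : ∑ i, |y i| ≤ m := Finset.sum_le_sum fun i _ => by simp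
  have hpos : 0 < pairForm 1 x y :=
    lt_of_le_of_ne (pairForm_nonneg Matrix.PosSemidef.one x y) fun h0 =>
      hxy (eq_zero_of_pairForm_eq_zero Matrix.PosDef.one h0.symm)
  have h1 : 1 < r ^ 2 / s ^ 2 := by
    rw [one_lt_div (by positivity)]
    exact pow_lt_pow_left₀ hlt hs0.le two_ne_zero
  obtain ⟨k, hk⟩ := pow_unbounded_of_one_lt
    (Fintype.card ι * (2 * (C * m) ^ 2) / pairForm 1 x y) h1
  have h2 : (r ^ 2) ^ k * pairForm 1 x y ≤
      Fintype.card ι * (2 * (C * m) ^ 2) * (s ^ 2) ^ k := by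
    rw [← hpow, hone]
    refine (Finset.sum_le_card_nsmul _ _ (2 * (C * m) ^ 2 * (s ^ 2) ^ k) fun i _ => ?_).trans ?_
    · have := hbd x hxm k i
      have := hbd y hym k i
      linarith
    · simp [mul_assoc]
  rw [div_lt_iff₀ hpos, div_pow, div_mul_eq_mul_div, lt_div_iff₀ (by positivity)] at hk
  exact absurd h2 (not_le.2 hk)

end Eigenvector

/-! ### Error covariance as a function of the age. -/

namespace Plant

variable {p : Plant}

/-- Covariance of the remote estimation error when the age of information is `a`. -/
def ageCov (p : Plant) : ℕ → Matrix (Fin p.l) (Fin p.l) ℝ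
  | 0 => p.Pbar
  | a + 1 => p.A * ageCov p a * p.Aᵀ + p.W

theorem posSemidef_ageCov (hp : p.SteadyKalman) (a : ℕ) : (p.ageCov a).PosSemidef := by
  induction a with
  | zero => exact hp.posSemidef_Pbar
  | succ a ih =>
    have := ih.mul_mul_conjTranspose_same p.A
    rw [Matrix.conjTranspose_eq_transpose_of_trivial] at this
    exact this.add hp.posSemidef_W

theorem posSemidef_priorCov (hp : p.SteadyKalman) : p.priorCov.PosSemidef :=
  posSemidef_ageCov hp 1

theorem posDef_innovCov (hp : p.SteadyKalman) : p.innovCov.PosDef := by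
  have h := (posSemidef_priorCov hp).mul_mul_conjTranspose_same p.C
  rw [Matrix.conjTranspose_eq_transpose_of_trivial] at h
  exact (h.add hp.posSemidef_V).posDef_iff_isUnit.2
    ((Matrix.isUnit_iff_isUnit_det _).2 hp.isUnit_innovCov)

theorem transpose_priorCov (hp : p.SteadyKalman) : p.priorCovᵀ = p.priorCov := by
  simpa [Matrix.IsHermitian] using (posSemidef_priorCov hp).isHermitian

theorem transpose_innovCov (hp : p.SteadyKalman) : p.innovCovᵀ = p.innovCov := by
  simpa [Matrix.IsHermitian] using (posDef_innovCov hp).isHermitian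

theorem transpose_gain (hp : p.SteadyKalman) :
    p.gainᵀ = p.innovCov⁻¹ * (p.C * p.priorCov) := by
  rw [gain, Matrix.transpose_mul, Matrix.transpose_mul, Matrix.transpose_transpose,
    transpose_priorCov hp, Matrix.transpose_nonsing_inv, transpose_innovCov hp]

theorem gain_mul_innovCov (hp : p.SteadyKalman) : p.gain * p.innovCov = p.priorCov * p.Cᵀ := by
  rw [gain, Matrix.mul_assoc, Matrix.nonsing_inv_mul _ hp.isUnit_innovCov, Matrix.mul_one]

/-- Joseph form of the posterior covariance update. -/
theorem joseph_form (hp : p.SteadyKalman) :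
    (1 - p.gain * p.C) * p.priorCov * (1 - p.gain * p.C)ᵀ + p.gain * p.V * p.gainᵀ = p.Pbar := by
  have h1 : p.V = p.innovCov - p.C * p.priorCov * p.Cᵀ := by rw [innovCov]; abel
  have h2 := gain_mul_innovCov hp
  rw [← hp.steady, h1, Matrix.mul_sub, h2, Matrix.transpose_sub, Matrix.transpose_one,
    Matrix.transpose_mul]
  simp only [Matrix.mul_sub, Matrix.sub_mul, Matrix.mul_one, Matrix.one_mul, Matrix.mul_assoc]
  abel

/-- With `S = innovCov`, the covariance removed by a measurement is `K C P⁻ = (P⁻ Cᵀ) S⁻¹ (P⁻ Cᵀ)ᵀ`,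
a form that vanishes only where `C P⁻` does. -/
theorem pairForm_priorCov (hp : p.SteadyKalman) (x y : Fin p.l → ℝ) :
    pairForm p.priorCov x y = pairForm p.Pbar x y +
      pairForm p.innovCov⁻¹ ((p.C * p.priorCov) *ᵥ x) ((p.C * p.priorCov) *ᵥ y) := by
  have h : p.priorCov = p.Pbar + (p.priorCov * p.Cᵀ) * p.innovCov⁻¹ * (p.priorCov * p.Cᵀ)ᵀ := by
    rw [Matrix.transpose_mul, Matrix.transpose_transpose, transpose_priorCov hp, ← gain,
      ← Matrix.mul_assoc]
    rw [← hp.steady, Matrix.sub_mul, Matrix.one_mul, sub_add_cancel]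
  have h2 : p.C * p.priorCov = (p.priorCov * p.Cᵀ)ᵀ := by
    rw [Matrix.transpose_mul, Matrix.transpose_transpose, transpose_priorCov hp]
  rw [h2, ← pairForm_conj, ← pairForm_add, ← h]

/-- A stable Kalman filter excites every non-decaying mode of the process. -/
theorem pairForm_Pbar_lt_priorCov (hp : p.SteadyKalman) {a b r : ℝ} (hr1 : 1 ≤ r)
    {x y : Fin p.l → ℝ} (hr : a ^ 2 + b ^ 2 = r ^ 2) (hxy : ¬ (x = 0 ∧ y = 0))
    (hx : p.Aᵀ *ᵥ x = a • x - b • y) (hy : p.Aᵀ *ᵥ y = b • x + a • y) :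
    pairForm p.Pbar x y < pairForm p.priorCov x y := by
  have hS := (posDef_innovCov hp).inv
  have hnn := pairForm_nonneg hS.posSemidef ((p.C * p.priorCov) *ᵥ x) ((p.C * p.priorCov) *ᵥ y)
  rw [pairForm_priorCov hp]
  refine lt_of_le_of_ne (by linarith) fun heq => ?_
  obtain ⟨h1, h2⟩ := eq_zero_of_pairForm_eq_zero hS (left_eq_add.1 heq)
  -- In case of equality `C P⁻`, hence `Kᵀ`, kills the mode. The filter matrix `(1 - K C) A` then
  -- keeps this left mode of modulus `r ≥ 1`, against its stability.
  have key : ∀ z, (p.C * p.priorCov) *ᵥ z = 0 →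
      ((1 - p.gain * p.C) * p.A)ᵀ *ᵥ z = p.Aᵀ *ᵥ z := by
    intro z hz
    have hg : p.gainᵀ *ᵥ z = 0 := by
      rw [transpose_gain hp, ← Matrix.mulVec_mulVec, hz, Matrix.mulVec_zero]
    rw [Matrix.transpose_mul, ← Matrix.mulVec_mulVec, Matrix.transpose_sub, Matrix.sub_mulVec,
      Matrix.transpose_one, Matrix.one_mulVec, Matrix.transpose_mul, ← Matrix.mulVec_mulVec, hg,
      Matrix.mulVec_zero, sub_zero]
  have := le_specRad_of_left_eigenvector hr hxy ((key x h1).trans hx) ((key y h2).trans hy)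
  linarith [hp.stable]

/-- Growth of the error covariance of a non-decaying process. -/
theorem exists_le_trace_ageCov (hp : p.SteadyKalman) (hr : 1 ≤ specRad p.A) :
    ∃ d, 0 < d ∧ ∀ a, d * ∑ j ∈ Finset.range a, (specRad p.A ^ 2) ^ j ≤ (p.ageCov a).trace := by
  obtain ⟨a, b, x, y, hab, hxy, hx, hy⟩ :=
    exists_left_eigenvector_of_specRad_pos (zero_lt_one.trans_le hr)
  set q : ℕ → ℝ := fun k => pairForm (p.ageCov k) x y with hq
  -- On the dominant mode the covariance recursion becomes scalar and affine, so its increments are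
  -- geometric; the first one is positive by `pairForm_Pbar_lt_priorCov`.
  have hstep : ∀ k, q (k + 1) = specRad p.A ^ 2 * q k + pairForm p.W x y := fun k => by
    simp only [hq, ageCov]
    rw [pairForm_add, pairForm_conj, hx, hy, pairForm_rotate, hab]
  have hd : 0 < q 1 - q 0 := sub_pos.2 (pairForm_Pbar_lt_priorCov hp hr hab hxy hx hy)
  have hdiff : ∀ k, q (k + 1) - q k = (q 1 - q 0) * (specRad p.A ^ 2) ^ k := by
    intro k
    induction k with
    | zero => simp
    | succ k ih =>
      rw [pow_succ, ← mul_assoc, ← ih, hstep (k + 1)]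
      nth_rewrite 2 [hstep k]
      ring
  have hsum : ∀ k, (q 1 - q 0) * ∑ j ∈ Finset.range k, (specRad p.A ^ 2) ^ j ≤ q k := by
    intro k
    have h0 : 0 ≤ q 0 := pairForm_nonneg (posSemidef_ageCov hp 0) x y
    have := Finset.sum_range_sub q k
    rw [Finset.sum_congr rfl fun j _ => hdiff j, ← Finset.mul_sum] at this
    linarith
  have hn : 0 < x ⬝ᵥ x + y ⬝ᵥ y := by
    have h0 := pairForm_nonneg Matrix.PosSemidef.one x y
    refine lt_of_le_of_ne ?_ fun h => hxy (eq_zero_of_pairForm_eq_zero Matrix.PosDef.one ?_)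
    · simpa [pairForm] using h0
    · simpa [pairForm] using h.symm
  refine ⟨(q 1 - q 0) / (x ⬝ᵥ x + y ⬝ᵥ y), by positivity, fun k => ?_⟩
  rw [div_mul_eq_mul_div, div_le_iff₀ hn]
  refine (hsum k).trans ?_
  have h1 := dotProduct_mulVec_le_trace (posSemidef_ageCov hp k) x
  have h2 := dotProduct_mulVec_le_trace (posSemidef_ageCov hp k) y
  simp only [hq, pairForm]
  linarith

theorem ageCov_eq_sum (p : Plant) (a : ℕ) : p.ageCov a = p.A ^ a * p.Pbar * (p.A ^ a)ᵀ +
    ∑ j ∈ Finset.range a, p.A ^ j * p.W * (p.A ^ j)ᵀ := by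
  induction a with
  | zero => simp [ageCov]
  | succ a ih =>
    rw [ageCov, ih, Finset.sum_range_succ', Matrix.mul_add, Matrix.add_mul, Finset.mul_sum,
      Finset.sum_mul]
    simp only [pow_succ', Matrix.transpose_mul, Matrix.mul_assoc, pow_zero, Matrix.one_mul,
      Matrix.transpose_one, Matrix.mul_one, add_assoc]

/-- The error covariance grows no faster than `r ^ a` when `r ≥ 1` exceeds the squared spectral
radius. -/
theorem exists_trace_ageCov_le (p : Plant) {r : ℝ} (hr1 : 1 ≤ r) (hr : specRad p.A ^ 2 < r) :
    ∃ C, 0 ≤ C ∧ ∀ a, (p.ageCov a).trace ≤ C * r ^ a := by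
  have hs : specRad p.A < Real.sqrt r := (Real.lt_sqrt (specRad_nonneg _)).2 hr
  obtain ⟨s, hs1, hs2⟩ := exists_between hs
  have hs0 : 0 ≤ s := (specRad_nonneg _).trans hs1.le
  have hsr : s ^ 2 < r := (Real.lt_sqrt hs0).1 hs2
  obtain ⟨C, hC0, hC⟩ := exists_abs_pow_apply_le hs1
  have hX : ∀ X : Matrix (Fin p.l) (Fin p.l) ℝ, ∀ j, (p.A ^ j * X * (p.A ^ j)ᵀ).trace ≤
      (p.l * C ^ 2 * ∑ b, ∑ c, |X c b|) * (s ^ 2) ^ j := by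
    intro X j
    have h1 : (p.A ^ j * X * (p.A ^ j)ᵀ).trace =
        ∑ i, ∑ b, ∑ c, (p.A ^ j) i c * X c b * (p.A ^ j) i b := by
      simp only [Matrix.trace, Matrix.diag_apply, Matrix.mul_apply, Matrix.transpose_apply,
        Finset.sum_mul]
    have h2 : ∀ i, ∑ b, ∑ c, (p.A ^ j) i c * X c b * (p.A ^ j) i b ≤
        (C * s ^ j) ^ 2 * ∑ b, ∑ c, |X c b| := by
      intro i
      simp only [Finset.mul_sum]
      refine Finset.sum_le_sum fun b _ => Finset.sum_le_sum fun c _ => (le_abs_self _).trans ?_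
      rw [abs_mul, abs_mul]
      have := hC j i c
      have := hC j i b
      calc _ ≤ (C * s ^ j) * |X c b| * (C * s ^ j) := by gcongr
        _ = _ := by ring
    rw [h1]
    refine (Finset.sum_le_card_nsmul _ _ _ fun i _ => h2 i).trans (le_of_eq ?_)
    simp only [Finset.card_univ, Fintype.card_fin, nsmul_eq_mul]
    ring
  set CP := p.l * C ^ 2 * ∑ b, ∑ c, |p.Pbar c b|
  set CW := p.l * C ^ 2 * ∑ b, ∑ c, |p.W c b|
  have hCP : 0 ≤ CP := by positivity
  have hCW : 0 ≤ CW := by positivity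
  have hrs : 0 < r - s ^ 2 := sub_pos.2 hsr
  refine ⟨CP + CW * (r / (r - s ^ 2)), by positivity, fun a => ?_⟩
  rw [ageCov_eq_sum, Matrix.trace_add, Matrix.trace_sum, add_mul]
  have hr0 : 0 < r := by linarith
  refine add_le_add ((hX _ _).trans ?_) ((Finset.sum_le_sum fun j _ => hX _ j).trans ?_)
  · exact mul_le_mul_of_nonneg_left (pow_le_pow_left₀ (sq_nonneg s) hsr.le a) hCP
  · rw [← Finset.mul_sum, mul_assoc CW]
    refine (mul_le_mul_of_nonneg_left ?_ hCW : CW * _ ≤ CW * _)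
    have hq1 : s ^ 2 / r < 1 := (div_lt_one hr0).2 hsr
    have hq0 : 0 ≤ s ^ 2 / r := by positivity
    -- Since `r ≥ 1`, `r ^ j` may be raised to `r ^ a`; the room between `s ^ 2` and `r` leaves a
    -- convergent geometric series and no factor `a`.
    have h1 : ∑ j ∈ Finset.range a, (s ^ 2) ^ j ≤ r ^ a * ∑ j ∈ Finset.range a, (s ^ 2 / r) ^ j := by
      rw [Finset.mul_sum]
      refine Finset.sum_le_sum fun j hj => ?_
      rw [div_pow, mul_div_assoc', le_div_iff₀ (by positivity), mul_comm]
      exact mul_le_mul_of_nonneg_right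
        (pow_le_pow_right₀ hr1 (Finset.mem_range.1 hj).le) (by positivity)
    have h2 : ∑ j ∈ Finset.range a, (s ^ 2 / r) ^ j ≤ r / (r - s ^ 2) := by
      refine ((summable_geometric_of_lt_one hq0 hq1).sum_le_tsum _
        fun j _ => by positivity).trans (le_of_eq ?_)
      rw [tsum_geometric_of_lt_one hq0 hq1]
      field_simp
    calc _ ≤ _ := h1
      _ ≤ r ^ a * (r / (r - s ^ 2)) := mul_le_mul_of_nonneg_left h2 (by positivity)
      _ = _ := mul_comm _ _

end Plant

/-! ### Second moments of linear images and of independent sums. -/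

section SecondMoment

variable {Ω : Type*} [MeasurableSpace Ω] {ι κ : Type*} [Fintype ι]

/-- Uncentered second moment matrix of a random vector. -/
noncomputable def secondMoment (μ : Measure Ω) (X : Ω → EuclideanSpace ℝ ι) : Matrix ι ι ℝ :=
  Matrix.of fun i j => ∫ ω, X ω i * X ω j ∂μ

variable {μ : Measure Ω}

theorem memLp_apply {X : Ω → EuclideanSpace ℝ ι} (hX : MemLp X 2 μ) (i : ι) :
    MemLp (fun ω => X ω i) 2 μ :=
  (EuclideanSpace.proj (𝕜 := ℝ) i).comp_memLp' hX

theorem integrable_apply_mul [Fintype κ] {X : Ω → EuclideanSpace ℝ ι} {Y : Ω → EuclideanSpace ℝ κ}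
    (hX : MemLp X 2 μ) (hY : MemLp Y 2 μ) (i : ι) (j : κ) :
    Integrable (fun ω => X ω i * Y ω j) μ :=
  (memLp_apply hX i).integrable_mul (memLp_apply hY j)

theorem memLp_toEuclideanLin [DecidableEq ι] [Fintype κ] {X : Ω → EuclideanSpace ℝ ι} (hX : MemLp X 2 μ)
    (B : Matrix κ ι ℝ) : MemLp (fun ω => B.toEuclideanLin (X ω)) 2 μ :=
  (LinearMap.toContinuousLinearMap B.toEuclideanLin).comp_memLp' hX

theorem toEuclideanLin_apply_coord [DecidableEq ι] (B : Matrix κ ι ℝ) (x : EuclideanSpace ℝ ι)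
    (i : κ) : B.toEuclideanLin x i = ∑ a, B i a * x a := rfl

theorem secondMoment_toEuclideanLin [DecidableEq ι] {X : Ω → EuclideanSpace ℝ ι}
    (hX : MemLp X 2 μ) (B : Matrix κ ι ℝ) :
    secondMoment μ (fun ω => B.toEuclideanLin (X ω)) = B * secondMoment μ X * Bᵀ := by
  ext i j
  simp only [secondMoment, Matrix.of_apply, Matrix.mul_apply, Matrix.transpose_apply,
    toEuclideanLin_apply_coord, Finset.sum_mul_sum]
  have hint := fun a b => integrable_apply_mul hX hX a b
  have h1 : ∀ ω, ∑ a, ∑ b, B i a * X ω a * (B j b * X ω b) =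
      ∑ a, ∑ b, B i a * B j b * (X ω a * X ω b) := fun ω =>
    Finset.sum_congr rfl fun a _ => Finset.sum_congr rfl fun b _ => by ring
  simp only [h1]
  rw [integral_finsetSum _ fun a _ => integrable_finsetSum _ fun b _ => (hint a b).const_mul _]
  simp only [integral_finsetSum _ fun b _ => (hint _ b).const_mul _, integral_const_mul,
    Finset.sum_mul]
  rw [Finset.sum_comm]
  exact Finset.sum_congr rfl fun a _ => Finset.sum_congr rfl fun b _ => by ring

theorem integral_toEuclideanLin_eq_zero [DecidableEq ι] [IsFiniteMeasure μ]
    {X : Ω → EuclideanSpace ℝ ι} (hX : MemLp X 2 μ) (hX0 : ∀ i, ∫ ω, X ω i ∂μ = 0)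
    (B : Matrix κ ι ℝ) (j : κ) : ∫ ω, B.toEuclideanLin (X ω) j ∂μ = 0 := by
  simp only [toEuclideanLin_apply_coord]
  rw [integral_finsetSum _ fun a _ =>
    ((memLp_apply hX a).integrable (by norm_num)).const_mul _]
  simp [integral_const_mul, hX0]

/-- Independence factors the cross terms, and the zero mean of `Y` alone kills them. `X` need not be
centred, which matters because no mean is prescribed for the initial error. -/
theorem secondMoment_add {X Y : Ω → EuclideanSpace ℝ ι} (hX : MemLp X 2 μ) (hY : MemLp Y 2 μ)
    (hXY : IndepFun X Y μ) (hY0 : ∀ i, ∫ ω, Y ω i ∂μ = 0) :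
    secondMoment μ (fun ω => X ω + Y ω) = secondMoment μ X + secondMoment μ Y := by
  ext i j
  simp only [secondMoment, Matrix.of_apply, Matrix.add_apply, PiLp.add_apply]
  have hc : ∀ i j, ∫ ω, X ω i * Y ω j ∂μ = 0 := fun i j => by
    have h := hXY.comp (φ := fun x : EuclideanSpace ℝ ι => x i)
      (ψ := fun x : EuclideanSpace ℝ ι => x j) (by fun_prop) (by fun_prop)
    have h2 := h.integral_fun_mul_eq_mul_integral (memLp_apply hX i).aestronglyMeasurable
      (memLp_apply hY j).aestronglyMeasurable
    simp only [Function.comp_apply] at h2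
    rw [h2, hY0, mul_zero]
  have h1 : ∀ ω, (X ω i + Y ω i) * (X ω j + Y ω j) =
      (X ω i * X ω j + Y ω i * Y ω j) + (X ω i * Y ω j + X ω j * Y ω i) := fun ω => by ring
  simp only [h1]
  have i1 := integrable_apply_mul hX hX i j
  have i2 := integrable_apply_mul hY hY i j
  have i3 := integrable_apply_mul hX hY i j
  have i4 := integrable_apply_mul hX hY j i
  rw [integral_add (i1.fun_add i2) (i3.fun_add i4), integral_add i1 i2, integral_add i3 i4, hc,
    hc]
  ring

theorem secondMoment_neg {ι : Type*} (X : Ω → EuclideanSpace ℝ ι) :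
    secondMoment μ (fun ω => -X ω) = secondMoment μ X := by
  ext i j
  simp [secondMoment]

theorem lintegral_enorm_sq_eq_trace {X : Ω → EuclideanSpace ℝ ι} (hX : MemLp X 2 μ) :
    ∫⁻ ω, ‖X ω‖ₑ ^ 2 ∂μ = ENNReal.ofReal (secondMoment μ X).trace := by
  have h1 : ∀ ω, ‖X ω‖ₑ ^ 2 = ENNReal.ofReal (∑ i, X ω i * X ω i) := fun ω => by
    rw [← ofReal_norm, ← ENNReal.ofReal_pow (norm_nonneg _), EuclideanSpace.norm_sq_eq]
    simp only [Real.norm_eq_abs, sq_abs]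
    simp only [sq]
  have hint := fun i => integrable_apply_mul hX hX i i
  simp only [h1]
  rw [← ofReal_integral_eq_lintegral_ofReal (integrable_finsetSum _ fun i _ => hint i)
    (ae_of_all _ fun ω => Finset.sum_nonneg fun i _ => mul_self_nonneg _),
    integral_finsetSum _ fun i _ => hint i]
  rfl

section Gaussian

variable [DecidableEq ι] {S : Matrix ι ι ℝ} {X : Ω → EuclideanSpace ℝ ι}

theorem memLp_of_hasLaw_multivariateGaussian (h : HasLaw X (multivariateGaussian 0 S) μ) :
    MemLp X 2 μ := by
  have h2 : MemLp id 2 (μ.map X) := h.map_eq ▸ IsGaussian.memLp_two_id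
  exact (memLp_map_measure_iff h2.aestronglyMeasurable h.aemeasurable).1 h2

theorem integral_apply_of_hasLaw_multivariateGaussian
    (h : HasLaw X (multivariateGaussian 0 S) μ) (i : ι) : ∫ ω, X ω i ∂μ = 0 := by
  have h1 := h.integral_comp (f := fun x : EuclideanSpace ℝ ι => x i)
    (by fun_prop)
  simp only [Function.comp_def] at h1
  rw [h1]
  have h2 := (EuclideanSpace.proj (𝕜 := ℝ) i).integral_comp_comm
    (IsGaussian.integrable_fun_id (μ := multivariateGaussian 0 S))
  simpa using h2

theorem secondMoment_of_hasLaw_multivariateGaussian (hS : S.PosSemidef)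
    (h : HasLaw X (multivariateGaussian 0 S) μ) : secondMoment μ X = S := by
  ext i j
  rw [← covariance_eval_multivariateGaussian hS (μ := 0) i j,
    ← h.covariance_fun_comp (f := fun x => x i) (g := fun x => x j) (by fun_prop) (by fun_prop),
    covariance]
  simp only [integral_apply_of_hasLaw_multivariateGaussian h, sub_zero]
  rfl

end Gaussian

end SecondMoment

/-! ### From the mean-square error to the law of the age. -/

namespace Sources

variable {Ω : Type*} {N M K : ℕ} {p : Fin N → Plant} (s : Sources Ω p K)

/-- Error at time `t` of the estimate obtained by propagating the local estimate at time
`t - a`. -/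
noncomputable def delayedErr (n : Fin N) : ℕ → ℕ → Ω → (p n).X
  | t, 0, ω => s.xs n t ω - s.x n t ω
  -- A default never met by the remote estimate, whose age is at most `t` (`aoi_le`).
  | 0, _ + 1, _ => 0
  | t + 1, a + 1, ω => (p n).A.toEuclideanLin (delayedErr n t a ω) - s.w n t ω

theorem delayedErr_zero (n : Fin N) (t : ℕ) (ω : Ω) :
    s.delayedErr n t 0 ω = s.xs n t ω - s.x n t ω := by
  cases t <;> rfl

theorem delayedErr_succ (n : Fin N) (t a : ℕ) (ω : Ω) : s.delayedErr n (t + 1) (a + 1) ω =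
    (p n).A.toEuclideanLin (s.delayedErr n t a ω) - s.w n t ω := rfl

/-- Reception restarts the prediction from the local estimate, failure prolongs it by one step.
Channel and policy now enter only through the age. -/
theorem xhat_sub_x (c : Channel M K) (π : Policy N M K) (n : Fin N) (t : ℕ) (ω : Ω) :
    s.xhat c π n t ω - s.x n t ω = s.delayedErr n t (s.aoi c π t ω n) ω := by
  induction t with
  | zero => rfl
  | succ t ih =>
    simp only [xhat, aoi, x]
    split_ifs with h
    · rw [delayedErr_succ, delayedErr_zero, map_sub]
      abel
    · rw [delayedErr_succ, ← ih, map_sub]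
      abel

theorem aoi_le (c : Channel M K) (π : Policy N M K) (n : Fin N) (t : ℕ) (ω : Ω) :
    s.aoi c π t ω n ≤ t := by
  induction t with
  | zero => rfl
  | succ t ih =>
    simp only [aoi]
    split_ifs <;> omega

theorem one_le_aoi (c : Channel M K) (π : Policy N M K) (n : Fin N) (t : ℕ) (ω : Ω) :
    1 ≤ s.aoi c π (t + 1) ω n := by
  simp only [aoi]
  split_ifs <;> omega

/-- The local estimation error is the innovation update of the one-step prediction error. -/
theorem delayedErr_zero_succ (n : Fin N) (t : ℕ) (ω : Ω) : s.delayedErr n (t + 1) 0 ω =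
    (1 - (p n).gain * (p n).C).toEuclideanLin (s.delayedErr n (t + 1) 1 ω) +
      (p n).gain.toEuclideanLin (s.v n (t + 1) ω) := by
  have h1 : ∀ z : (p n).X, (1 - (p n).gain * (p n).C).toEuclideanLin z =
      z - (p n).gain.toEuclideanLin ((p n).C.toEuclideanLin z) := fun z => by
    simp [Matrix.toLpLin_apply, Matrix.mulVec_mulVec]
  rw [delayedErr_zero, delayedErr_succ, delayedErr_zero, h1]
  simp only [xs, y, x, map_sub, map_add]
  abel

/-- The initial condition of plant `n`, its process noises before time `t` and its measurement
noises before time `u`. -/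
def pastIdx (n : Fin N) (t u : ℕ) : Set (SourceIdx N) :=
  {i | i = .init n ∨ (∃ k < t, i = .w n k) ∨ ∃ k < u, i = .v n k}

/-- The σ-algebra generated by the sources in `pastIdx n t u`. -/
@[reducible]
def pastSigma (n : Fin N) (t u : ℕ) : MeasurableSpace Ω := ⨆ i ∈ pastIdx n t u, s.sigma i

theorem sigma_le_pastSigma {n : Fin N} {t u : ℕ} {i : SourceIdx N} (hi : i ∈ pastIdx n t u) :
    s.sigma i ≤ s.pastSigma n t u :=
  le_iSup₂ (f := fun i (_ : i ∈ pastIdx n t u) => s.sigma i) i hi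

theorem pastSigma_mono (n : Fin N) {t t' u u' : ℕ} (ht : t ≤ t') (hu : u ≤ u') :
    s.pastSigma n t u ≤ s.pastSigma n t' u' := by
  refine biSup_mono fun i hi => ?_
  rcases hi with h | ⟨k, hk, h⟩ | ⟨k, hk, h⟩
  exacts [Or.inl h, Or.inr (Or.inl ⟨k, hk.trans_le ht, h⟩),
    Or.inr (Or.inr ⟨k, hk.trans_le hu, h⟩)]

theorem w_notMem_pastIdx (n : Fin N) (t u : ℕ) :
    (SourceIdx.w n t : SourceIdx N) ∉ pastIdx n t u := by
  rintro (h | ⟨k, hk, h⟩ | ⟨k, hk, h⟩)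
  · cases h
  · cases h
    exact lt_irrefl _ hk
  · cases h

theorem v_notMem_pastIdx (n : Fin N) (t u : ℕ) :
    (SourceIdx.v n u : SourceIdx N) ∉ pastIdx n t u := by
  rintro (h | ⟨k, hk, h⟩ | ⟨k, hk, h⟩)
  · cases h
  · cases h
  · cases h
    exact lt_irrefl _ hk

theorem channel_notMem_pastIdx (n : Fin N) (t u : ℕ) :
    (SourceIdx.channel : SourceIdx N) ∉ pastIdx n t u := by
  rintro (h | ⟨k, hk, h⟩ | ⟨k, hk, h⟩) <;> cases h

theorem measurable_toEuclideanLin {l k : ℕ} (B : Matrix (Fin k) (Fin l) ℝ) :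
    Measurable B.toEuclideanLin :=
  (LinearMap.toContinuousLinearMap B.toEuclideanLin).continuous.measurable

theorem measurable_w_pastSigma {n : Fin N} {k t : ℕ} (h : k < t) (u : ℕ) :
    Measurable[s.pastSigma n t u] (s.w n k) :=
  (comap_measurable (s.w n k)).mono
    (s.sigma_le_pastSigma (i := .w n k) (Or.inr (Or.inl ⟨k, h, rfl⟩))) le_rfl

theorem measurable_v_pastSigma {n : Fin N} {k u : ℕ} (t : ℕ) (h : k < u) :
    Measurable[s.pastSigma n t u] (s.v n k) :=
  (comap_measurable (s.v n k)).mono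
    (s.sigma_le_pastSigma (i := .v n k) (Or.inr (Or.inr ⟨k, h, rfl⟩))) le_rfl

theorem measurable_init_pastSigma (n : Fin N) (t u : ℕ) :
    Measurable[s.pastSigma n t u] (fun ω => (s.x0 n ω, s.xs0 n ω)) :=
  (comap_measurable (fun ω => (s.x0 n ω, s.xs0 n ω))).mono
    (s.sigma_le_pastSigma (i := .init n) (Or.inl rfl)) le_rfl

/-- A prediction step uses `w n t` but no new measurement noise. Keeping `u` fixed leaves `v n (t +
1)` independent of the one-step prediction error at time `t + 1`. -/
theorem measurable_delayedErr_succ_pastSigma {n : Fin N} {t u a : ℕ}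
    (h : Measurable[s.pastSigma n t u] (s.delayedErr n t a)) :
    Measurable[s.pastSigma n (t + 1) u] (s.delayedErr n (t + 1) (a + 1)) :=
  ((measurable_toEuclideanLin _).comp
    (h.mono (s.pastSigma_mono n t.le_succ le_rfl) le_rfl)).sub
      (s.measurable_w_pastSigma t.lt_succ_self u)

theorem measurable_delayedErr_pastSigma (n : Fin N) (t a : ℕ) :
    Measurable[s.pastSigma n t (t + 1)] (s.delayedErr n t a) := by
  induction t generalizing a with
  | zero =>
    cases a with
    | zero =>
      exact (measurable_snd.comp (s.measurable_init_pastSigma n 0 1)).sub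
        (measurable_fst.comp (s.measurable_init_pastSigma n 0 1))
    | succ a => exact measurable_const
  | succ t ih =>
    have hsucc : ∀ a, Measurable[s.pastSigma n (t + 1) (t + 2)]
        (s.delayedErr n (t + 1) (a + 1)) := fun a =>
      (s.measurable_delayedErr_succ_pastSigma (ih a)).mono
        (s.pastSigma_mono n le_rfl (Nat.le_succ _)) le_rfl
    cases a with
    | zero =>
      have : s.delayedErr n (t + 1) 0 = fun ω =>
          (1 - (p n).gain * (p n).C).toEuclideanLin (s.delayedErr n (t + 1) 1 ω) +
            (p n).gain.toEuclideanLin (s.v n (t + 1) ω) :=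
        funext fun ω => s.delayedErr_zero_succ n t ω
      rw [this]
      exact ((measurable_toEuclideanLin _).comp (hsucc 0)).add
        ((measurable_toEuclideanLin _).comp (s.measurable_v_pastSigma _ (Nat.lt_succ_self _)))
    | succ a => exact hsucc a

theorem measurable_h_sigma (t : ℕ) :
    Measurable[s.sigma .channel] (s.h t) :=
  Measurable.of_comap_le (le_iSup (fun t => MeasurableSpace.comap (s.h t) ⊤) t)

-- Policies see only ages and the channel state, so by recursion the age is a function of the
-- channel; all maps between the countable spaces involved are measurable.
open Classical in
theorem measurable_aoi_sigma (c : Channel M K) (π : Policy N M K) (t : ℕ) :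
    Measurable[s.sigma .channel] (s.aoi c π t) := by
  induction t with
  | zero => exact measurable_const
  | succ t ih =>
    have h : s.aoi c π (t + 1) = (fun q : (Fin N → ℕ) × Fin K => fun n =>
        if ∃ m, π.sel q.1 q.2 n = some m ∧ c.on q.2 m = true then 1 else q.1 n + 1) ∘
        fun ω => (s.aoi c π t ω, s.h t ω) := by
      funext ω n
      simp only [aoi, Received, Function.comp_apply]
      congr
    rw [h]
    exact (measurable_of_countable _).comp (ih.prodMk (s.measurable_h_sigma t))

variable [mΩ : MeasurableSpace Ω] {μ : Measure Ω} {c : Channel M K} {s}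

theorem IsModel.sigma_le (hs : s.IsModel c μ) (i : SourceIdx N) : s.sigma i ≤ mΩ := by
  cases i with
  | channel => exact iSup_le fun t => (hs.measurable_h t).comap_le
  | init n => exact ((hs.measurable_x0 n).prodMk (hs.measurable_xs0 n)).comap_le
  | w n t => exact (hs.measurable_w n t).comap_le
  | v n t => exact (hs.measurable_v n t).comap_le

theorem IsModel.pastSigma_le (hs : s.IsModel c μ) (n : Fin N) (t u : ℕ) :
    s.pastSigma n t u ≤ mΩ :=
  iSup₂_le fun i _ => hs.sigma_le i

theorem IsModel.indep_pastSigma (hs : s.IsModel c μ) {n : Fin N} {t u : ℕ} {i : SourceIdx N}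
    (hi : i ∉ pastIdx n t u) : Indep (s.pastSigma n t u) (s.sigma i) μ := by
  have h := indep_iSup_of_disjoint hs.sigma_le hs.indep (Set.disjoint_singleton_right.2 hi)
  simpa only [iSup_singleton] using h

/-- Induction on time for all ages at once. A positive age is a prediction step, which adds `W`. Age
`0` is the measurement update of age `1` at the same time, and the Joseph form returns it to `Pbar`.
-/
theorem IsModel.memLp_and_secondMoment_delayedErr [IsProbabilityMeasure μ]
    (hp : ∀ n, (p n).SteadyKalman) (hs : s.IsModel c μ) (n : Fin N) {t a : ℕ} (ha : a ≤ t) :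
    MemLp (s.delayedErr n t a) 2 μ ∧
      secondMoment μ (s.delayedErr n t a) = (p n).ageCov a := by
  induction t generalizing a with
  | zero =>
    obtain rfl : a = 0 := by omega
    refine ⟨hs.memLp_init n, ?_⟩
    ext i j
    exact hs.cov_init n i j
  | succ t ih =>
    have hsucc : ∀ a ≤ t, MemLp (s.delayedErr n (t + 1) (a + 1)) 2 μ ∧
        secondMoment μ (s.delayedErr n (t + 1) (a + 1)) = (p n).ageCov (a + 1) := by
      intro a ha
      obtain ⟨h1, h2⟩ := ih ha
      have hw := memLp_of_hasLaw_multivariateGaussian (hs.law_w n t)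
      have hX := memLp_toEuclideanLin h1 (p n).A
      have hind : IndepFun (fun ω => (p n).A.toEuclideanLin (s.delayedErr n t a ω))
          (fun ω => -s.w n t ω) μ := by
        refine (IndepFun_iff_Indep _ _ μ).2 (indep_of_indep_of_le_left
          (indep_of_indep_of_le_right (hs.indep_pastSigma (w_notMem_pastIdx n t (t + 1))) ?_) ?_)
        · exact (Measurable.neg (comap_measurable (s.w n t))).comap_le
        · exact ((measurable_toEuclideanLin _).comp
            (s.measurable_delayedErr_pastSigma n t a)).comap_le
      have hadd := secondMoment_add hX hw.neg hind fun i => by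
        simp [integral_neg, integral_apply_of_hasLaw_multivariateGaussian (hs.law_w n t) i]
      have heq : s.delayedErr n (t + 1) (a + 1) =
          fun ω => (p n).A.toEuclideanLin (s.delayedErr n t a ω) + -s.w n t ω :=
        funext fun ω => by rw [delayedErr_succ, sub_eq_add_neg]
      rw [heq]
      refine ⟨hX.add hw.neg, hadd.trans ?_⟩
      rw [secondMoment_toEuclideanLin h1, h2]
      erw [secondMoment_neg]
      rw [secondMoment_of_hasLaw_multivariateGaussian (hp n).posSemidef_W (hs.law_w n t)]
      rfl
    cases a with
    | succ a => exact hsucc a (by omega)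
    | zero =>
      obtain ⟨h1, h2⟩ := hsucc 0 (Nat.zero_le _)
      have hv := memLp_of_hasLaw_multivariateGaussian (hs.law_v n (t + 1))
      have hX := memLp_toEuclideanLin h1 (1 - (p n).gain * (p n).C)
      have hY := memLp_toEuclideanLin hv (p n).gain
      have hind : IndepFun
          (fun ω => (1 - (p n).gain * (p n).C).toEuclideanLin (s.delayedErr n (t + 1) 1 ω))
          (fun ω => (p n).gain.toEuclideanLin (s.v n (t + 1) ω)) μ := by
        refine (IndepFun_iff_Indep _ _ μ).2 (indep_of_indep_of_le_left
          (indep_of_indep_of_le_right (hs.indep_pastSigma (v_notMem_pastIdx n (t + 1) (t + 1))) ?_) ?_)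
        · exact ((measurable_toEuclideanLin _).comp
            (comap_measurable (s.v n (t + 1)))).comap_le
        · exact ((measurable_toEuclideanLin _).comp (s.measurable_delayedErr_succ_pastSigma
            (s.measurable_delayedErr_pastSigma n t 0))).comap_le
      have hadd := secondMoment_add hX hY hind (integral_toEuclideanLin_eq_zero hv
        (integral_apply_of_hasLaw_multivariateGaussian (hs.law_v n (t + 1))) _)
      have heq : s.delayedErr n (t + 1) 0 = fun ω =>
          (1 - (p n).gain * (p n).C).toEuclideanLin (s.delayedErr n (t + 1) 1 ω) +
            (p n).gain.toEuclideanLin (s.v n (t + 1) ω) :=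
        funext fun ω => s.delayedErr_zero_succ n t ω
      rw [heq]
      refine ⟨hX.add hY, hadd.trans ?_⟩
      rw [secondMoment_toEuclideanLin h1, secondMoment_toEuclideanLin hv, h2,
        secondMoment_of_hasLaw_multivariateGaussian (hp n).posSemidef_V (hs.law_v n (t + 1))]
      exact Plant.joseph_form (hp n)

/-- The mean-square error is the expectation of the trace of the error covariance at the current
age of information. -/
theorem IsModel.mse_eq [IsProbabilityMeasure μ] (hp : ∀ n, (p n).SteadyKalman)
    (hs : s.IsModel c μ) (π : Policy N M K) (n : Fin N) (t : ℕ) :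
    s.mse μ c π n t = ∫⁻ ω, ENNReal.ofReal ((p n).ageCov (s.aoi c π t ω n)).trace ∂μ := by
  classical
  have hage : Measurable[s.sigma .channel] fun ω => s.aoi c π t ω n :=
    (measurable_pi_apply n).comp (s.measurable_aoi_sigma c π t)
  -- Split over the values `a ≤ t` of the age: the indicator belongs to the channel and the error of
  -- fixed age to the plant, so each expectation factors.
  set I : ℕ → Ω → ℝ≥0∞ := fun a ω => if s.aoi c π t ω n = a then 1 else 0
  have hI : ∀ a, Measurable[s.sigma .channel] (I a) := fun a =>
    (measurable_of_countable fun k : ℕ => if k = a then (1 : ℝ≥0∞) else 0).comp hage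
  have hI' : ∀ a, Measurable (I a) := fun a => (hI a).mono (hs.sigma_le .channel) le_rfl
  have hsplit : ∀ (g : ℕ → Ω → ℝ≥0∞) ω, g (s.aoi c π t ω n) ω =
      ∑ a ∈ Finset.range (t + 1), I a ω * g a ω := by
    intro g ω
    simp only [I, ite_mul, one_mul, zero_mul]
    rw [Finset.sum_ite_eq, if_pos]
    exact Finset.mem_range.2 (Nat.lt_succ_of_le (s.aoi_le c π n t ω))
  have h1 : ∀ ω, ‖s.xhat c π n t ω - s.x n t ω‖ₑ ^ 2 =
      ∑ a ∈ Finset.range (t + 1), I a ω * ‖s.delayedErr n t a ω‖ₑ ^ 2 := fun ω => by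
    rw [xhat_sub_x]
    exact hsplit (fun a ω => ‖s.delayedErr n t a ω‖ₑ ^ 2) ω
  have h2 : ∀ ω, ENNReal.ofReal ((p n).ageCov (s.aoi c π t ω n)).trace =
      ∑ a ∈ Finset.range (t + 1), I a ω * ENNReal.ofReal ((p n).ageCov a).trace := fun ω =>
    hsplit (fun a _ => ENNReal.ofReal ((p n).ageCov a).trace) ω
  simp only [mse, h1, h2]
  have hD : ∀ a, Measurable[s.pastSigma n t (t + 1)] fun ω => ‖s.delayedErr n t a ω‖ₑ ^ 2 :=
    fun a => (measurable_enorm.comp (s.measurable_delayedErr_pastSigma n t a)).pow_const 2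
  have hD' : ∀ a, Measurable fun ω => ‖s.delayedErr n t a ω‖ₑ ^ 2 := fun a =>
    (hD a).mono (hs.pastSigma_le n t _) le_rfl
  rw [lintegral_finsetSum _ fun a _ => (hI' a).fun_mul (hD' a),
    lintegral_finsetSum _ fun a _ => (hI' a).fun_mul measurable_const]
  refine Finset.sum_congr rfl fun a ha => ?_
  obtain ⟨hm, hcov⟩ := hs.memLp_and_secondMoment_delayedErr hp n
    (Nat.lt_succ_iff.1 (Finset.mem_range.1 ha))
  rw [lintegral_mul_eq_lintegral_mul_lintegral_of_independent_measurableSpace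
    (hs.sigma_le .channel) (hs.pastSigma_le n t (t + 1))
    (hs.indep_pastSigma (channel_notMem_pastIdx n t (t + 1))).symm (hI a) (hD a),
    lintegral_enorm_sq_eq_trace hm, hcov, lintegral_mul_const _ (hI' a)]

end Sources

/-! ### Markov property and occupation times of the channel. -/

theorem integral_comp_eq_sum {Ω β : Type*} [MeasurableSpace Ω] {μ : Measure Ω}
    [IsFiniteMeasure μ] [Fintype β] [MeasurableSpace β] [MeasurableSingletonClass β] {Z : Ω → β}
    (hZ : Measurable Z) (g : β → ℝ) :
    ∫ ω, g (Z ω) ∂μ = ∑ z, μ.real {ω | Z ω = z} * g z := by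
  rw [← integral_map (φ := Z) hZ.aemeasurable (measurable_of_finite g).aestronglyMeasurable,
    integral_fintype Integrable.of_finite]
  refine Finset.sum_congr rfl fun z _ => ?_
  rw [map_measureReal_apply hZ (measurableSet_singleton z), smul_eq_mul]
  rfl

namespace Sources

variable {Ω : Type*} {N M K : ℕ} {p : Fin N → Plant} (s : Sources Ω p K)

/-- The channel states up to time `t`. -/
def path (t : ℕ) (ω : Ω) : Fin (t + 1) → Fin K := fun k => s.h k ω

theorem path_eq_iff (t : ℕ) (ω : Ω) (i : ℕ → Fin K) :
    s.path t ω = (fun k : Fin (t + 1) => i k) ↔ ∀ k ≤ t, s.h k ω = i k :=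
  ⟨fun h k hk => congrFun h ⟨k, Nat.lt_succ_of_le hk⟩,
    fun h => funext fun k => h k (Nat.le_of_lt_succ k.2)⟩

theorem h_eq_of_path_eq {t k : ℕ} (hk : k ≤ t) {ω ω' : Ω} (h : s.path t ω = s.path t ω') :
    s.h k ω = s.h k ω' :=
  congrFun h ⟨k, Nat.lt_succ_of_le hk⟩

theorem aoi_eq_of_h_eq (c : Channel M K) (π : Policy N M K) {t : ℕ} {ω ω' : Ω}
    (h : ∀ k < t, s.h k ω = s.h k ω') : s.aoi c π t ω = s.aoi c π t ω' := by
  induction t with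
  | zero => rfl
  | succ t ih =>
    funext n
    simp only [aoi, Received, ih fun k hk => h k (by omega), h t t.lt_succ_self]
    congr

/-- The age at time `t` uses the channel states before `t` only, hence `t ≤ u + 1`. This extra step
lets the age at `t + 1` be paired with the transition out of `h t`. -/
theorem factorsThrough_path {γ : Type*} (c : Channel M K) (π : Policy N M K) {t u k : ℕ}
    (ht : t ≤ u + 1) (hk : k ≤ u) (f : (Fin N → ℕ) → Fin K → γ) :
    Function.FactorsThrough (fun ω => f (s.aoi c π t ω) (s.h k ω)) (s.path u) := by
  intro ω ω' h
  simp only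
  rw [s.aoi_eq_of_h_eq c π fun k hk => s.h_eq_of_path_eq (show k ≤ u by omega) h,
    s.h_eq_of_path_eq hk h]

variable [mΩ : MeasurableSpace Ω] {μ : Measure Ω} {c : Channel M K} {s}

theorem IsModel.measurable_path (hs : s.IsModel c μ) (t : ℕ) : Measurable (s.path t) :=
  measurable_pi_lambda _ fun k => hs.measurable_h k

theorem IsModel.integrable_of_factorsThrough [IsProbabilityMeasure μ] (hs : s.IsModel c μ)
    {t : ℕ} {F : Ω → ℝ} (hF : F.FactorsThrough (s.path t)) : Integrable F μ := by
  have h : F = Function.extend (s.path t) F 0 ∘ s.path t :=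
    funext fun ω => (hF.extend_apply 0 ω).symm
  rw [h]
  exact Integrable.comp_measurable Integrable.of_finite (hs.measurable_path t)

theorem IsModel.measureReal_path_and [IsProbabilityMeasure μ] (hs : s.IsModel c μ) (t : ℕ)
    (q : Fin (t + 1) → Fin K) (j : Fin K) :
    μ.real {ω | (s.path t ω, s.h (t + 1) ω) = (q, j)} =
      μ.real {ω | s.path t ω = q} * c.P (q (Fin.last t)) j := by
  set i : ℕ → Fin K := fun k => if hk : k < t + 1 then q ⟨k, hk⟩ else j with hi
  have hq : q = fun k : Fin (t + 1) => i k := funext fun k => by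
    simp only [hi, dif_pos k.2]
  have hj : i (t + 1) = j := by simp [hi]
  have hl : i t = q (Fin.last t) := by simp [hi, Fin.last]
  have h1 : {ω | (s.path t ω, s.h (t + 1) ω) = (q, j)} = {ω | ∀ k ≤ t + 1, s.h k ω = i k} := by
    ext ω
    simp only [Set.mem_ofPred_eq, Prod.mk.injEq]
    rw [hq, path_eq_iff]
    constructor
    · rintro ⟨h1, h2⟩ k hk
      rcases Nat.lt_or_ge t k with h | h
      · obtain rfl : k = t + 1 := by omega
        rw [h2, hj]
      · exact h1 k h
    · exact fun h => ⟨fun k hk => h k (by omega), (h (t + 1) le_rfl).trans hj⟩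
  have h2 : {ω | s.path t ω = q} = {ω | ∀ k ≤ t, s.h k ω = i k} := by
    ext ω
    simp only [Set.mem_ofPred_eq]
    rw [hq, path_eq_iff]
  rw [h1, h2, hs.markov, hs.markov, Finset.prod_range_succ, hj, hl, mul_assoc]

/-- One-step Markov property of the channel for functionals of its past. -/
theorem IsModel.integral_mul_comp_h_succ [IsProbabilityMeasure μ] (hs : s.IsModel c μ)
    {t : ℕ} {F : Ω → ℝ} (hF : F.FactorsThrough (s.path t)) (y : Fin K → ℝ) :
    ∫ ω, F ω * y (s.h (t + 1) ω) ∂μ = ∫ ω, F ω * (c.P *ᵥ y) (s.h t ω) ∂μ := by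
  set f := Function.extend (s.path t) F 0
  have hf : ∀ ω, F ω = f (s.path t ω) := fun ω => (hF.extend_apply 0 ω).symm
  have h1 := integral_comp_eq_sum (μ := μ) ((hs.measurable_path t).prodMk (hs.measurable_h (t + 1)))
    (fun z => f z.1 * y z.2)
  have h2 := integral_comp_eq_sum (μ := μ) (hs.measurable_path t)
    (fun q => f q * (c.P *ᵥ y) (q (Fin.last t)))
  have e1 : ∀ ω, s.path t ω (Fin.last t) = s.h t ω := fun ω => rfl
  simp only [e1] at h2
  simp only [hf]
  rw [h1, h2, Fintype.sum_prod_type]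
  refine Finset.sum_congr rfl fun q _ => ?_
  simp only [hs.measureReal_path_and, Matrix.mulVec, dotProduct, Finset.mul_sum]
  exact Finset.sum_congr rfl fun j _ => by ring

theorem IsModel.integral_comp_h_add [IsProbabilityMeasure μ] (hs : s.IsModel c μ)
    (t k : ℕ) (y : Fin K → ℝ) :
    ∫ ω, y (s.h (t + k) ω) ∂μ = ∫ ω, ((c.P ^ k) *ᵥ y) (s.h t ω) ∂μ := by
  induction k generalizing y with
  | zero => simp
  | succ k ih =>
    have h := hs.integral_mul_comp_h_succ (t := t + k) (F := fun _ => 1) (fun _ _ _ => rfl) y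
    simp only [one_mul] at h
    rw [← add_assoc, h, ih, Matrix.mulVec_mulVec, pow_succ]

/-- Every state of an irreducible chain has infinite expected occupation time. -/
theorem IsModel.tendsto_sum_measureReal_h [IsProbabilityMeasure μ] (hs : s.IsModel c μ)
    (hP : c.P.IsIrreducible) (i : Fin K) :
    Tendsto (fun t => ∑ k ∈ Finset.range t, μ.real {ω | s.h k ω = i}) atTop atTop := by
  rw [← not_summable_iff_tendsto_nat_atTop_of_nonneg fun _ => measureReal_nonneg]
  intro hsum
  have hi : Tendsto (fun k => μ.real {ω | s.h k ω = i}) atTop (nhds 0) :=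
    hsum.tendsto_atTop_zero
  have hint : ∀ (t : ℕ) (y : Fin K → ℝ), ∫ ω, y (s.h t ω) ∂μ =
      ∑ j, μ.real {ω | s.h t ω = j} * y j := fun t y =>
    integral_comp_eq_sum (hs.measurable_h t) y
  -- If the probability of `i` tends to `0`, so does that of every `j` leading to `i` in a fixed
  -- number of steps. By irreducibility this is every state, yet the probabilities sum to `1`.
  have hj : ∀ j, Tendsto (fun k => μ.real {ω | s.h k ω = j}) atTop (nhds 0) := by
    intro j
    obtain ⟨k, -, hk⟩ := (Matrix.isIrreducible_iff_exists_pow_pos hP.nonneg).1 hP j i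
    have h1 : Tendsto (fun t => μ.real {ω | s.h (t + k) ω = i} / (c.P ^ k) j i) atTop
        (nhds (0 / (c.P ^ k) j i)) := ((tendsto_add_atTop_iff_nat k).2 hi).div_const _
    rw [zero_div] at h1
    refine squeeze_zero (fun _ => measureReal_nonneg) (fun t => ?_) h1
    rw [le_div_iff₀ hk]
    have h2 := hs.integral_comp_h_add t k (Pi.single i 1)
    rw [hint, hint] at h2
    simp only [Matrix.mulVec_single_one, Matrix.col_apply, Pi.single_apply, mul_ite, mul_one,
      mul_zero, Finset.sum_ite_eq', Finset.mem_univ, if_true] at h2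
    rw [h2]
    exact Finset.single_le_sum (f := fun j => μ.real {ω | s.h t ω = j} * (c.P ^ k) j i)
      (fun l _ => mul_nonneg measureReal_nonneg (pow_apply_nonneg hP.nonneg k l i))
      (Finset.mem_univ j)
  have hone : ∀ t, ∑ j, μ.real {ω | s.h t ω = j} = 1 := fun t => by
    have := hint t 1
    simpa using this.symm
  have hlim := tendsto_finsetSum Finset.univ fun j _ => hj j
  simp only [hone, Finset.sum_const_zero] at hlim
  exact one_ne_zero (tendsto_nhds_unique tendsto_const_nhds hlim)

end Sources

/-! ### Ranking sensors by age. -/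

section Rank

variable {N : ℕ}

/-- Ages of information ordered with ties broken by the sensor index. -/
def ageKey (φ : Fin N → ℕ) (n : Fin N) : ℕ ×ₗ Fin N := toLex (φ n, n)

theorem ageKey_lt_iff (φ : Fin N → ℕ) (k n : Fin N) :
    ageKey φ k < ageKey φ n ↔ φ k < φ n ∨ φ k = φ n ∧ k < n :=
  Prod.Lex.toLex_lt_toLex

theorem exists_ageKey_max (hN : 0 < N) (φ : Fin N → ℕ) : ∃ m, ∀ k, ageKey φ k ≤ ageKey φ m :=
  have : Nonempty (Fin N) := ⟨⟨0, hN⟩⟩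
  Finite.exists_max (ageKey φ)

/-- Number of sensors that are fresher than sensor `n`. -/
def ageRank (φ : Fin N → ℕ) (n : Fin N) : ℕ :=
  (Finset.univ.filter fun k => ageKey φ k < ageKey φ n).card

theorem ageRank_le (φ : Fin N → ℕ) (n : Fin N) : ageRank φ n ≤ N :=
  (Finset.card_le_univ _).trans_eq (Fintype.card_fin N)

theorem ageRank_add_one (φ : Fin N → ℕ) (n : Fin N) :
    ageRank (fun k => φ k + 1) n = ageRank φ n := by
  simp only [ageRank, ageKey_lt_iff, Nat.add_lt_add_iff_right, Nat.add_right_cancel_iff]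

/-- Refreshing the sensor with the largest age moves it below all the others. -/
theorem ageRank_lt_of_refresh {φ : Fin N → ℕ} (hφ : ∀ k, 1 ≤ φ k) {m n : Fin N}
    (hm : ∀ k, ageKey φ k ≤ ageKey φ m) (hn : n ≠ m) :
    ageRank φ n + 1 ≤ ageRank (fun k => if k = m then 1 else φ k + 1) n := by
  -- The sensors fresher than `n` remain so, and `m`, which was not among them, joins them with age
  -- `1 < φ n + 1`.
  have hnot : m ∉ Finset.univ.filter fun k => ageKey φ k < ageKey φ n := by
    simpa using hm n
  rw [ageRank, ← Finset.card_insert_of_notMem hnot]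
  refine Finset.card_le_card fun k hk => ?_
  rw [Finset.mem_filter_univ, ageKey_lt_iff, if_neg hn]
  rcases Finset.mem_insert.1 hk with rfl | hk'
  · left
    rw [if_pos rfl]
    have := hφ n
    omega
  · rw [Finset.mem_filter_univ] at hk'
    have hkm : k ≠ m := by
      rintro rfl
      exact absurd hk' (not_lt.2 (hm n))
    rw [ageKey_lt_iff] at hk'
    rw [if_neg hkm]
    omega

end Rank

/-- The policy that serves the sensor with the largest age of information on channel `v i` whenever
that channel is on in the current state `i`. -/
noncomputable def greedyPolicy {N M K : ℕ} (hN : 0 < N) (c : Channel M K) (v : Fin K → Fin M) :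
    Policy N M K where
  sel φ i n := if c.on i (v i) = true ∧ n = (exists_ageKey_max hN φ).choose then some (v i) else none
  exclusive φ i n n' m h h' := by
    split_ifs at h h' with h1 h2
    exact h1.2.trans h2.2.symm

theorem greedyPolicy_sel {N M K : ℕ} (hN : 0 < N) (c : Channel M K) (v : Fin K → Fin M)
    (φ : Fin N → ℕ) (i : Fin K) (n : Fin N) : (greedyPolicy hN c v).sel φ i n =
      if c.on i (v i) = true ∧ n = (exists_ageKey_max hN φ).choose then some (v i) else none := rfl

/-! ### Sufficiency: drift of the discounted age under the greedy policy. -/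

namespace Sources

variable {Ω : Type*} {N M K : ℕ} {p : Fin N → Plant} (s : Sources Ω p K)

theorem aoi_greedyPolicy_succ (hN : 0 < N) (c : Channel M K) (v : Fin K → Fin M) (t : ℕ) (ω : Ω) :
    ∃ m, (∀ k, ageKey (s.aoi c (greedyPolicy hN c v) t ω) k ≤
        ageKey (s.aoi c (greedyPolicy hN c v) t ω) m) ∧
      s.aoi c (greedyPolicy hN c v) (t + 1) ω = fun n =>
        if c.on (s.h t ω) (v (s.h t ω)) = true ∧ n = m then 1
        else s.aoi c (greedyPolicy hN c v) t ω n + 1 := by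
  refine ⟨_, (exists_ageKey_max hN (s.aoi c (greedyPolicy hN c v) t ω)).choose_spec, ?_⟩
  funext n
  have hiff : s.Received c (greedyPolicy hN c v) (s.aoi c (greedyPolicy hN c v) t ω) n t ω ↔
      c.on (s.h t ω) (v (s.h t ω)) = true ∧
        n = (exists_ageKey_max hN (s.aoi c (greedyPolicy hN c v) t ω)).choose := by
    constructor
    · rintro ⟨m, h1, h2⟩
      by_contra h
      rw [greedyPolicy_sel, if_neg h] at h1
      cases h1
    · intro h
      exact ⟨v (s.h t ω), by rw [greedyPolicy_sel, if_pos h], h.1⟩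
  simp only [aoi, hiff]

/-- Discounted age of sensor `n`, the discount `θ` being paid for every fresher sensor. -/
noncomputable def agePotential (r θ : ℝ) (φ : Fin N → ℕ) (n : Fin N) : ℝ :=
  r ^ φ n * θ ^ ageRank φ n

/-- On failure all ages grow and ranks persist: factor `r`. On success the served sensor restarts at
a cost of at most `r`, and every other one gains a rank: factor `r * θ`. Time `0` is excluded
because there all ages are `0` and a refreshed sensor would not become fresher than the others. -/
theorem agePotential_greedyPolicy_succ_le (hN : 0 < N) (c : Channel M K) (v : Fin K → Fin M)
    {r θ : ℝ} (hr : 0 ≤ r) (hθ0 : 0 ≤ θ) (hθ1 : θ ≤ 1) {t : ℕ} (ht : 1 ≤ t) (n : Fin N) (ω : Ω) :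
    agePotential r θ (s.aoi c (greedyPolicy hN c v) (t + 1) ω) n ≤
      r * (if c.on (s.h t ω) (v (s.h t ω)) = true then θ else 1) *
        agePotential r θ (s.aoi c (greedyPolicy hN c v) t ω) n + r := by
  obtain ⟨m, hm, hsucc⟩ := s.aoi_greedyPolicy_succ hN c v t ω
  have hage : ∀ k, 1 ≤ s.aoi c (greedyPolicy hN c v) t ω k := fun k => by
    obtain ⟨u, rfl⟩ := Nat.exists_eq_add_of_le' ht
    exact s.one_le_aoi c _ k u ω
  rw [hsucc]
  set φ := s.aoi c (greedyPolicy hN c v) t ω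
  by_cases hon : c.on (s.h t ω) (v (s.h t ω)) = true
  · simp only [hon, true_and, if_true]
    by_cases hn : n = m
    · simp only [agePotential, if_pos hn, pow_one]
      have h1 : r * θ ^ ageRank (fun n => if n = m then 1 else φ n + 1) n ≤ r :=
        mul_le_of_le_one_right hr (pow_le_one₀ hθ0 hθ1)
      have h2 : 0 ≤ r * θ * (r ^ φ n * θ ^ ageRank φ n) := by positivity
      linarith
    · simp only [agePotential, if_neg hn]
      have h1 := pow_le_pow_of_le_one hθ0 hθ1 (ageRank_lt_of_refresh hage hm hn)
      calc _ ≤ r ^ (φ n + 1) * θ ^ (ageRank φ n + 1) :=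
            mul_le_mul_of_nonneg_left h1 (by positivity)
        _ = r * θ * (r ^ φ n * θ ^ ageRank φ n) := by ring
        _ ≤ _ := le_add_of_nonneg_right hr
  · simp only [if_neg hon, if_neg fun h : _ ∧ _ => hon h.1, agePotential, ageRank_add_one]
    rw [pow_succ]
    linarith

variable [mΩ : MeasurableSpace Ω] {μ : Measure Ω} {c : Channel M K} {s}

/-- Exponential moments of the age of information under the greedy policy. -/
theorem IsModel.exists_integral_pow_aoi_le [IsProbabilityMeasure μ] (hs : s.IsModel c μ)
    (hN : 0 < N) (hP : c.P ∈ Matrix.rowStochastic ℝ (Fin K)) (v : Fin K → Fin M) {r : ℝ}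
    (hr1 : 1 ≤ r) (hr : r * specRad (c.failure v * c.P) < 1) :
    ∃ C, ∀ t, 1 ≤ t → ∀ n, ∫ ω, r ^ s.aoi c (greedyPolicy hN c v) t ω n ∂μ ≤ C := by
  obtain ⟨hP0, hP1⟩ := Matrix.mem_rowStochastic_iff_sum.1 hP
  have hr0 : 0 < r := by linarith
  obtain ⟨y, hy1, hy⟩ := exists_mulVec_le_sub_half (B := r • (c.failure v * c.P))
    (fun i j => mul_nonneg hr0.le (Channel.failure_mul_nonneg hP0 v i j))
    (by rwa [specRad_smul hr0.le])
  set Y : ℝ := 1 + ∑ i, y i with hYdef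
  have hy0 : ∀ i, 0 ≤ y i := fun i => zero_le_one.trans (hy1 i)
  have hyY : ∀ i, y i ≤ Y := fun i => by
    have := Finset.single_le_sum (f := y) (fun i _ => hy0 i) (Finset.mem_univ i)
    linarith
  have hY1 : 1 ≤ Y := le_add_of_nonneg_right (Finset.sum_nonneg fun i _ => hy0 i)
  have hPy0 : ∀ i, 0 ≤ (c.P *ᵥ y) i := mulVec_nonneg_of_nonneg hP0 hy0
  have hPyY : ∀ i, (c.P *ᵥ y) i ≤ Y := fun i => by
    refine (mulVec_mono_of_nonneg hP0 hyY i).trans (le_of_eq ?_)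
    simp only [Matrix.mulVec, dotProduct]
    rw [← Finset.sum_mul, hP1, one_mul]
  have hY0 : 0 < Y := by linarith
  -- Chosen so that `r * θ * Y = 1 / 2`: after a success the drift is at most `1 / 2 ≤ y i - 1 / 2`,
  -- the same bound as after a failure. Then `y i ≤ Y` turns `y i - 1 / 2` into a contraction.
  set θ : ℝ := 1 / (2 * r * Y) with hθ
  have hθ0 : 0 < θ := by positivity
  have hrθ : r * θ * Y = 1 / 2 := by rw [hθ]; field_simp
  have hrY : 1 ≤ r * Y := one_le_mul_of_one_le_of_one_le hr1 hY1
  have hθ1 : θ ≤ 1 := by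
    rw [hθ, div_le_one (by positivity)]
    linarith
  have hdrift : ∀ i, r * (if c.on i (v i) = true then θ else 1) * (c.P *ᵥ y) i ≤
      (1 - 1 / (2 * Y)) * y i := by
    intro i
    have h1 : 1 / (2 * Y) * y i ≤ 1 / 2 := by
      rw [div_mul_eq_mul_div, div_le_div_iff₀ (by positivity) two_pos]
      have := hyY i
      linarith
    split_ifs with hon
    · have h2 : r * θ * (c.P *ᵥ y) i ≤ 1 / 2 := by
        rw [← hrθ]
        exact mul_le_mul_of_nonneg_left (hPyY i) (by positivity)
      have := hy1 i
      linarith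
    · have h2 := hy i
      have h3 : ((r • (c.failure v * c.P)) *ᵥ y) i = r * (c.P *ᵥ y) i := by
        rw [Matrix.smul_mulVec, Pi.smul_apply, smul_eq_mul]
        simp only [Matrix.mulVec, dotProduct, Channel.failure_mul_apply, hon]
        simp
      rw [h3] at h2
      linarith
  set π := greedyPolicy hN c v with hπ
  set Φ : ℕ → Fin N → Ω → ℝ := fun t n ω => agePotential r θ (s.aoi c π t ω) n with hΦ
  have hΦ0 : ∀ t n ω, 0 ≤ Φ t n ω := fun t n ω => by
    simp only [hΦ, agePotential]
    positivity
  have hint : ∀ t n (g : ℝ → Fin K → ℝ), Integrable (fun ω => g (Φ t n ω) (s.h t ω)) μ :=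
    fun t n g => hs.integrable_of_factorsThrough (t := t)
      (s.factorsThrough_path c π (Nat.le_succ t) le_rfl fun φ i => g (agePotential r θ φ n) i)
  -- The bound is the fixed point of `x ↦ (1 - 1 / (2 * Y)) * x + r * Y`.
  have hw : ∀ n t, 1 ≤ t → ∫ ω, Φ t n ω * y (s.h t ω) ∂μ ≤ 2 * r * Y ^ 2 := by
    intro n t ht
    induction t, ht using Nat.le_induction with
    | base =>
      have hone : ∀ ω, Φ 1 n ω * y (s.h 1 ω) ≤ r * Y := fun ω => by
        have hage : s.aoi c π 1 ω n = 1 :=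
          le_antisymm (s.aoi_le c π n 1 ω) (s.one_le_aoi c π n 0 ω)
        simp only [hΦ, agePotential, hage, pow_one]
        refine mul_le_mul (mul_le_of_le_one_right hr0.le (pow_le_one₀ hθ0.le hθ1)) (hyY _)
          (hy0 _) hr0.le
      refine (integral_mono (hint 1 n fun x i => x * y i) (integrable_const _) hone).trans ?_
      simp only [integral_const, probReal_univ, one_smul]
      have : r * Y ≤ r * Y * Y := le_mul_of_one_le_right (by positivity) hY1
      linarith [show 2 * r * Y ^ 2 = 2 * (r * Y * Y) by ring]
    | succ t ht ih =>
      have hF : (Φ (t + 1) n).FactorsThrough (s.path t) :=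
        s.factorsThrough_path c π le_rfl le_rfl fun φ _ => agePotential r θ φ n
      rw [hs.integral_mul_comp_h_succ hF]
      have hstep : ∀ ω, Φ (t + 1) n ω * (c.P *ᵥ y) (s.h t ω) ≤
          (1 - 1 / (2 * Y)) * (Φ t n ω * y (s.h t ω)) + r * Y := by
        intro ω
        have h1 := mul_le_mul_of_nonneg_right
          (s.agePotential_greedyPolicy_succ_le hN c v hr0.le hθ0.le hθ1 ht n ω) (hPy0 (s.h t ω))
        have h2 := mul_le_mul_of_nonneg_left (hdrift (s.h t ω)) (hΦ0 t n ω)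
        have h3 := mul_le_mul_of_nonneg_left (hPyY (s.h t ω)) hr0.le
        rw [add_mul] at h1
        refine h1.trans (add_le_add ?_ h3)
        calc _ = Φ t n ω * (r * (if c.on (s.h t ω) (v (s.h t ω)) = true then θ else 1) *
              (c.P *ᵥ y) (s.h t ω)) := by ring
          _ ≤ _ := h2
          _ = _ := by ring
      have hi2 := (hint t n fun x i => x * y i).const_mul (1 - 1 / (2 * Y))
      refine (integral_mono (hs.integrable_of_factorsThrough (t := t)
        (s.factorsThrough_path c π le_rfl le_rfl fun φ i =>
          agePotential r θ φ n * (c.P *ᵥ y) i)) (hi2.fun_add (integrable_const _)) hstep).trans ?_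
      rw [integral_add hi2 (integrable_const _), integral_const_mul, integral_const,
        probReal_univ, one_smul]
      have h4 : 0 ≤ 1 - 1 / (2 * Y) := by
        rw [sub_nonneg, div_le_one (by positivity)]
        linarith
      have h5 := mul_le_mul_of_nonneg_left ih h4
      have h6 : (1 - 1 / (2 * Y)) * (2 * r * Y ^ 2) + r * Y = 2 * r * Y ^ 2 := by
        field_simp
        ring
      linarith
  refine ⟨(θ ^ N)⁻¹ * (2 * r * Y ^ 2), fun t ht n => ?_⟩
  have hle : ∀ ω, r ^ s.aoi c π t ω n ≤ (θ ^ N)⁻¹ * (Φ t n ω * y (s.h t ω)) := by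
    intro ω
    rw [le_inv_mul_iff₀ (by positivity)]
    have h1 : θ ^ N ≤ θ ^ ageRank (s.aoi c π t ω) n :=
      pow_le_pow_of_le_one hθ0.le hθ1 (ageRank_le _ _)
    have h2 : θ ^ N * r ^ s.aoi c π t ω n ≤ Φ t n ω := by
      rw [mul_comm]
      exact mul_le_mul_of_nonneg_left h1 (by positivity)
    exact h2.trans (le_mul_of_one_le_right (hΦ0 t n ω) (hy1 _))
  have hi := (hint t n fun x i => x * y i).const_mul (θ ^ N)⁻¹
  refine (integral_mono (hs.integrable_of_factorsThrough (t := t)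
    (s.factorsThrough_path c π (Nat.le_succ t) le_rfl fun φ _ => r ^ φ n)) hi hle).trans ?_
  rw [integral_const_mul]
  exact mul_le_mul_of_nonneg_left (hw n t ht) (by positivity)

/-- A uniform bound on the mean-square errors bounds the average cost. -/
theorem avgCost_lt_top {π : Policy N M K} (h : ∀ n, ∃ C : ℝ, ∀ t, 1 ≤ t →
    s.mse μ c π n t ≤ ENNReal.ofReal C) : s.avgCost μ c π < ∞ := by
  refine ENNReal.sum_lt_top.2 fun n _ => ?_
  obtain ⟨C, hC⟩ := h n
  refine lt_of_le_of_lt ?_ (ENNReal.ofReal_lt_top (r := C))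
  refine limsup_le_of_le (by isBoundedDefault) (Eventually.of_forall fun T => ?_)
  refine ENNReal.div_le_of_le_mul ?_
  refine (Finset.sum_le_card_nsmul _ _ _ fun t ht => hC t (Finset.mem_Icc.1 ht).1).trans ?_
  rw [Nat.card_Icc, Nat.add_sub_cancel, nsmul_eq_mul, mul_comm]

theorem IsModel.stabilizable [IsProbabilityMeasure μ] (hp : ∀ n, (p n).SteadyKalman)
    (hs : s.IsModel c μ) (hN : 0 < N) (hP : c.P ∈ Matrix.rowStochastic ℝ (Fin K))
    (v : Fin K → Fin M) (h : (⨆ n, specRad (p n).A) ^ 2 * specRad (c.failure v * c.P) < 1) :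
    s.Stabilizable μ c := by
  set ρ := ⨆ n, specRad (p n).A
  set l := specRad (c.failure v * c.P)
  have hl0 : 0 ≤ l := specRad_nonneg _
  have hl1 : l ≤ 1 := Channel.specRad_failure_mul_le_one hP v
  have hle : ∀ n, specRad (p n).A ≤ ρ := le_ciSup (Set.finite_range _).bddAbove
  have hρ0 : 0 ≤ ρ := (specRad_nonneg _).trans (hle ⟨0, hN⟩)
  have hgrow : ∀ {π : Policy N M K} {r C : ℝ}, 1 ≤ r → ρ ^ 2 < r → (∀ t, 1 ≤ t → ∀ n,
      ∫ ω, r ^ s.aoi c π t ω n ∂μ ≤ C) → s.avgCost μ c π < ∞ := by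
    intro π r C hr1 hr hC
    refine avgCost_lt_top fun n => ?_
    obtain ⟨D, hD0, hD⟩ := Plant.exists_trace_ageCov_le (p n) hr1
      ((pow_le_pow_left₀ (specRad_nonneg _) (hle n) 2).trans_lt hr)
    refine ⟨D * C, fun t ht => ?_⟩
    have hint : Integrable (fun ω => D * r ^ s.aoi c π t ω n) μ :=
      hs.integrable_of_factorsThrough (t := t)
        (s.factorsThrough_path c π (Nat.le_succ t) le_rfl fun φ _ => D * r ^ φ n)
    rw [hs.mse_eq hp]
    refine (lintegral_mono fun ω => ENNReal.ofReal_le_ofReal (hD _)).trans ?_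
    rw [← ofReal_integral_eq_lintegral_ofReal hint (ae_of_all _ fun ω => by positivity),
      integral_const_mul]
    exact ENNReal.ofReal_le_ofReal (mul_le_mul_of_nonneg_left (hC t ht n) hD0)
  refine ⟨greedyPolicy hN c v, ?_⟩
  -- For `ρ < 1` the covariances are bounded over all ages and `r = 1` suffices. Otherwise
  -- continuity leaves room for `r` above `ρ ^ 2` with `r * l < 1`.
  rcases lt_or_ge ρ 1 with hρ | hρ
  · refine hgrow (r := 1) (C := 1) le_rfl (by nlinarith) fun t _ n => ?_
    simp
  · obtain ⟨r, hr, hrl⟩ : ∃ r, ρ ^ 2 < r ∧ r * l < 1 := by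
      have hc : ContinuousAt (fun r : ℝ => r * l) (ρ ^ 2) := by fun_prop
      have h1 : ∀ᶠ r in nhdsWithin (ρ ^ 2) (Set.Ioi (ρ ^ 2)), r * l < 1 :=
        (hc.eventually_lt_const h).filter_mono nhdsWithin_le_nhds
      obtain ⟨r, h2, h3⟩ := (h1.and self_mem_nhdsWithin).exists
      exact ⟨r, h3, h2⟩
    have hr1 : 1 ≤ r := (one_le_pow₀ hρ).trans hr.le
    obtain ⟨C, hC⟩ := hs.exists_integral_pow_aoi_le hN hP v hr1 hrl
    exact hgrow hr1 hr hC

end Sources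

/-! ### Necessity: divergence under every policy. -/

/-- For an irreducible channel with an on state and `1 ≤ R * specRad (V P)` there is a subinvariant
weight vector which is charged when leaving some on state. -/
theorem Channel.exists_subinvariant_charged {M K : ℕ} {c : Channel M K} (hP : c.P.IsIrreducible)
    (v : Fin K → Fin M) {R : ℝ} (hR : 0 ≤ R) (h : 1 ≤ R * specRad (c.failure v * c.P)) {i₀ : Fin K}
    (hi₀ : c.on i₀ (v i₀) = true) :
    ∃ y : Fin K → ℝ, (∀ i, 0 ≤ y i) ∧ (∀ i, y i ≤ R * ((c.failure v * c.P) *ᵥ y) i) ∧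
      ∃ i, c.on i (v i) = true ∧ 0 < (c.P *ᵥ y) i := by
  set B := R • (c.failure v * c.P) with hB
  have hB0 : ∀ i j, 0 ≤ B i j := fun i j =>
    mul_nonneg hR (failure_mul_nonneg hP.nonneg v i j)
  have hBv : ∀ (y : Fin K → ℝ) i, (B *ᵥ y) i = R * ((c.failure v * c.P) *ᵥ y) i := fun y i => by
    rw [hB, Matrix.smul_mulVec, Pi.smul_apply, smul_eq_mul]
  have hVP : ∀ (y : Fin K → ℝ) i, ((c.failure v * c.P) *ᵥ y) i =
      if c.on i (v i) = true then 0 else (c.P *ᵥ y) i := fun y i => by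
    simp only [Matrix.mulVec, dotProduct, failure_mul_apply]
    split_ifs <;> simp
  obtain ⟨y, hy0, ⟨j, hj⟩, hy⟩ := exists_le_mulVec hB0 (by rwa [hB, specRad_smul hR])
  have hm0 : ∀ m i, 0 ≤ ((B ^ m) *ᵥ y) i := fun m =>
    mulVec_nonneg_of_nonneg (pow_apply_nonneg hB0 m) hy0
  have hsucc : ∀ m, (B ^ (m + 1)) *ᵥ y = B *ᵥ ((B ^ m) *ᵥ y) := fun m => by
    rw [Matrix.mulVec_mulVec, pow_succ']
  have hmsub : ∀ m i, ((B ^ m) *ᵥ y) i ≤ (B *ᵥ ((B ^ m) *ᵥ y)) i := by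
    intro m
    induction m with
    | zero => simpa using hy
    | succ m ih =>
      rw [hsucc]
      exact mulVec_mono_of_nonneg hB0 ih
  -- All iterates `B ^ m y` are subinvariant. If none were charged, `P` would send each of them to a
  -- vector vanishing on the on states, where alone `V` differs from the identity. Then `R P` and
  -- `B` agree on them, so every `P ^ (k + 1) y` vanishes at `i₀`, although `i₀` leads to a `j` with
  -- `y j > 0`.
  by_contra! hcon
  have hzero : ∀ m i, c.on i (v i) = true → (c.P *ᵥ ((B ^ m) *ᵥ y)) i = 0 := fun m i hi =>
    le_antisymm (hcon _ (hm0 m) (fun i => by rw [← hBv]; exact hmsub m i) i hi)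
      (mulVec_nonneg_of_nonneg hP.nonneg (hm0 m) i)
  have hRP : ∀ m, R • (c.P *ᵥ ((B ^ m) *ᵥ y)) = (B ^ (m + 1)) *ᵥ y := fun m => by
    funext i
    rw [hsucc, hBv, hVP, Pi.smul_apply, smul_eq_mul]
    split_ifs with hi
    · rw [hzero m i hi]
    · rfl
  have hRpos : R ≠ 0 := by
    rintro rfl
    norm_num at h
  have hpow : ∀ k m i, c.on i (v i) = true → ((c.P ^ (k + 1)) *ᵥ ((B ^ m) *ᵥ y)) i = 0 := by
    intro k
    induction k with
    | zero =>
      intro m i hi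
      rw [zero_add, pow_one]
      exact hzero m i hi
    | succ k ih =>
      intro m i hi
      have h1 := ih (m + 1) i hi
      rw [← hRP, Matrix.mulVec_smul, Matrix.mulVec_mulVec, ← pow_succ, Pi.smul_apply,
        smul_eq_mul] at h1
      exact (mul_eq_zero.1 h1).resolve_left hRpos
  obtain ⟨k, hk0, hk⟩ := (Matrix.isIrreducible_iff_exists_pow_pos hP.nonneg).1 hP i₀ j
  obtain ⟨k, rfl⟩ := Nat.exists_eq_add_of_le' hk0
  have h1 := hpow k 0 i₀ hi₀
  rw [pow_zero, Matrix.one_mulVec] at h1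
  have h2 : (c.P ^ (k + 1)) i₀ j * y j ≤ ((c.P ^ (k + 1)) *ᵥ y) i₀ :=
    Finset.single_le_sum (f := fun l => (c.P ^ (k + 1)) i₀ l * y l)
      (fun l _ => mul_nonneg (pow_apply_nonneg hP.nonneg _ _ _) (hy0 l)) (Finset.mem_univ j)
  rw [h1] at h2
  exact absurd h2 (not_le.2 (mul_pos hk hj))

/-- Cesàro means of a sequence tending to infinity tend to infinity. -/
theorem limsup_cesaro_eq_top {a : ℕ → ℝ≥0∞} (ha : Tendsto a atTop (nhds ∞)) :
    limsup (fun T : ℕ => (∑ t ∈ Finset.Icc 1 T, a t) / (T : ℝ≥0∞)) atTop = ∞ := by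
  refine ENNReal.eq_top_of_forall_nnreal_le fun b => ?_
  obtain ⟨n, hn⟩ := eventually_atTop.1 ((tendsto_order.1 ha).1 _
    (show ((2 * b : NNReal) : ℝ≥0∞) < ∞ from ENNReal.coe_lt_top))
  refine le_limsup_of_frequently_le (Eventually.frequently ?_) (by isBoundedDefault)
  -- At least half of the terms up to `T` then exceed `2 * b`.
  filter_upwards [eventually_ge_atTop (2 * n + 1)] with T hT
  rw [ENNReal.le_div_iff_mul_le (Or.inl (by simp; omega)) (Or.inl (by simp))]
  have h1 : ∑ t ∈ Finset.Ioc n T, a t ≤ ∑ t ∈ Finset.Icc 1 T, a t :=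
    Finset.sum_le_sum_of_subset fun t ht => by
      rw [Finset.mem_Ioc] at ht
      rw [Finset.mem_Icc]
      omega
  have h2 := Finset.card_nsmul_le_sum (Finset.Ioc n T) a ((2 * b : NNReal) : ℝ≥0∞) fun t ht =>
    (hn t (Finset.mem_Ioc.1 ht).1.le).le
  refine le_trans ?_ (h2.trans h1)
  rw [Nat.card_Ioc, nsmul_eq_mul]
  have h3 : b * (T : NNReal) ≤ ((T - n : ℕ) : NNReal) * (2 * b) := by
    have : (T : NNReal) ≤ ((T - n : ℕ) : NNReal) * 2 := by
      have h4 : T ≤ (T - n) * 2 := by omega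
      exact_mod_cast h4
    calc b * (T : NNReal) ≤ b * (((T - n : ℕ) : NNReal) * 2) := mul_le_mul_right this b
      _ = _ := by ring
  exact_mod_cast h3

namespace Sources

variable {Ω : Type*} {N M K : ℕ} {p : Fin N → Plant} [mΩ : MeasurableSpace Ω] {μ : Measure Ω}
  {c : Channel M K} {s : Sources Ω p K}

theorem avgCost_eq_top_of_tendsto_mse {π : Policy N M K} {n : Fin N}
    (h : Tendsto (s.mse μ c π n) atTop (nhds ∞)) : s.avgCost μ c π = ∞ :=
  ENNReal.sum_eq_top.2 ⟨n, Finset.mem_univ n, limsup_cesaro_eq_top h⟩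

/-- An age of information that grows with the channel permanently off drives the error of a
non-decaying process to infinity. -/
theorem IsModel.tendsto_mse_of_never_on [IsProbabilityMeasure μ] (hp : ∀ n, (p n).SteadyKalman)
    (hs : s.IsModel c μ) (π : Policy N M K) {n : Fin N} (hn : 1 ≤ specRad (p n).A)
    (hoff : ∀ i m, ¬ c.on i m = true) : Tendsto (s.mse μ c π n) atTop (nhds ∞) := by
  have hage : ∀ t ω, s.aoi c π t ω n = t := by
    intro t ω
    induction t with
    | zero => rfl
    | succ t ih =>
      simp only [aoi]
      rw [if_neg fun ⟨m, _, hm⟩ => hoff _ m hm, ih]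
  obtain ⟨d, hd0, hd⟩ := Plant.exists_le_trace_ageCov (hp n) hn
  have hle : ∀ t : ℕ, ENNReal.ofReal (d * t) ≤ s.mse μ c π n t := fun t => by
    rw [hs.mse_eq hp]
    simp only [hage, lintegral_const, measure_univ, mul_one]
    refine ENNReal.ofReal_le_ofReal (le_trans ?_ (hd t))
    refine mul_le_mul_of_nonneg_left ?_ hd0.le
    have := Finset.card_nsmul_le_sum (Finset.range t) (fun j => (specRad (p n).A ^ 2) ^ j) 1
      fun j _ => one_le_pow₀ (one_le_pow₀ hn)
    simpa using this
  refine tendsto_nhds_top_mono' (ENNReal.tendsto_ofReal_atTop.comp ?_) hle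
  exact tendsto_natCast_atTop_atTop.const_mul_atTop hd0

theorem IsModel.tendsto_mse_of_exists_on [IsProbabilityMeasure μ] (hp : ∀ n, (p n).SteadyKalman)
    (hs : s.IsModel c μ) (hP : c.P.IsIrreducible) (π : Policy N M K) {n : Fin N}
    (hn : 1 ≤ specRad (p n).A) {v : Fin K → Fin M}
    (hv : ∀ i m, c.on i m = true → c.on i (v i) = true)
    (h : 1 ≤ specRad (p n).A ^ 2 * specRad (c.failure v * c.P)) {i₀ : Fin K}
    (hi₀ : c.on i₀ (v i₀) = true) : Tendsto (s.mse μ c π n) atTop (nhds ∞) := by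
  set R := specRad (p n).A ^ 2 with hRdef
  have hR : 1 ≤ R := one_le_pow₀ hn
  obtain ⟨y, hy0, hy, i₁, hi₁, hb⟩ :=
    Channel.exists_subinvariant_charged hP v (zero_le_one.trans hR) h hi₀
  set b := (c.P *ᵥ y) i₁
  have hPy0 : ∀ i, 0 ≤ (c.P *ᵥ y) i := mulVec_nonneg_of_nonneg hP.nonneg hy0
  have hVP : ∀ i, ((c.failure v * c.P) *ᵥ y) i =
      if c.on i (v i) = true then 0 else (c.P *ᵥ y) i := fun i => by
    simp only [Matrix.mulVec, dotProduct, Channel.failure_mul_apply]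
    split_ifs <;> simp
  set φ : ℕ → Ω → ℕ := fun t ω => s.aoi c π t ω n with hφ
  have hint : ∀ t (g : ℕ → Fin K → ℝ), Integrable (fun ω => g (φ t ω) (s.h t ω)) μ := fun t g =>
    hs.integrable_of_factorsThrough (t := t)
      (s.factorsThrough_path c π (Nat.le_succ t) le_rfl fun f i => g (f n) i)
  -- In an on state subinvariance forces `y = 0`, so whatever the policy does the right side only
  -- has to cover the charge. In any other state reception is impossible and the age grows by one.
  have hstep : ∀ t ω, R ^ φ t ω * y (s.h t ω) + (if s.h t ω = i₁ then b else 0) ≤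
      R ^ φ (t + 1) ω * (c.P *ᵥ y) (s.h t ω) := by
    intro t ω
    have h1 := hy (s.h t ω)
    rw [hVP] at h1
    by_cases hon : c.on (s.h t ω) (v (s.h t ω)) = true
    · rw [if_pos hon, mul_zero] at h1
      rw [le_antisymm h1 (hy0 _), mul_zero, zero_add]
      have h2 : (c.P *ᵥ y) (s.h t ω) ≤ R ^ φ (t + 1) ω * (c.P *ᵥ y) (s.h t ω) :=
        le_mul_of_one_le_left (hPy0 _) (one_le_pow₀ hR)
      refine le_trans ?_ h2
      split_ifs with hi
      · rw [hi]
      · exact hPy0 _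
    · rw [if_neg hon] at h1
      have hne : s.h t ω ≠ i₁ := fun he => hon (he ▸ hi₁)
      have hsucc : φ (t + 1) ω = φ t ω + 1 := by
        simp only [hφ, aoi]
        exact if_neg fun ⟨m, _, hm⟩ => hon (hv _ m hm)
      rw [if_neg hne, add_zero, hsucc, pow_succ, mul_assoc]
      exact mul_le_mul_of_nonneg_left h1 (by positivity)
  set w : ℕ → ℝ := fun t => ∫ ω, R ^ φ t ω * y (s.h t ω) ∂μ with hw
  have hwstep : ∀ t, w t + b * μ.real {ω | s.h t ω = i₁} ≤ w (t + 1) := by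
    intro t
    have hF : Function.FactorsThrough (fun ω => R ^ φ (t + 1) ω) (s.path t) :=
      s.factorsThrough_path c π le_rfl le_rfl fun f _ => R ^ f n
    simp only [hw]
    rw [hs.integral_mul_comp_h_succ hF]
    have hi1 := hint t fun a i => R ^ a * y i
    have hi2 := hint t fun _ i => if i = i₁ then b else 0
    have h1 : ∫ ω, (if s.h t ω = i₁ then b else 0) ∂μ = b * μ.real {ω | s.h t ω = i₁} := by
      rw [integral_comp_eq_sum (hs.measurable_h t) fun i => if i = i₁ then b else 0]
      simp [mul_comm]
    rw [← h1, ← integral_add hi1 hi2]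
    exact integral_mono (hi1.add hi2) (hs.integrable_of_factorsThrough (t := t)
      (s.factorsThrough_path c π le_rfl le_rfl fun f i => R ^ f n * (c.P *ᵥ y) i)) (hstep t)
  have hwsum : ∀ t, b * ∑ k ∈ Finset.range t, μ.real {ω | s.h k ω = i₁} ≤ w t := by
    intro t
    induction t with
    | zero =>
      simp only [Finset.range_zero, Finset.sum_empty, mul_zero, hw]
      exact integral_nonneg fun ω => mul_nonneg (by positivity) (hy0 _)
    | succ t ih =>
      rw [Finset.sum_range_succ, mul_add]
      exact (add_le_add ih le_rfl).trans (hwstep t)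
  have hwtop : Tendsto w atTop atTop :=
    tendsto_atTop_mono hwsum ((hs.tendsto_sum_measureReal_h hP i₁).const_mul_atTop hb)
  obtain ⟨d, hd0, hd⟩ := Plant.exists_le_trace_ageCov (hp n) hn
  set Y := 1 + ∑ i, y i
  have hY0 : 0 < Y :=
    add_pos_of_pos_of_nonneg one_pos (Finset.sum_nonneg fun i _ => hy0 i)
  have hyY : ∀ i, y i ≤ Y := fun i => by
    have := Finset.single_le_sum (f := y) (fun i _ => hy0 i) (Finset.mem_univ i)
    linarith
  -- At age `a + 1` the trace is at least `d * R ^ a`, the last term of the geometric sum: this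
  -- costs the factor `R`, and `y ≤ Y` the factor `Y`.
  have hle : ∀ t, 1 ≤ t → ENNReal.ofReal (d / (R * Y) * w t) ≤ s.mse μ c π n t := by
    intro t ht
    rw [hs.mse_eq hp]
    simp only [hw]
    rw [← integral_const_mul, ofReal_integral_eq_lintegral_ofReal
      ((hint t fun a i => R ^ a * y i).const_mul _)
      (ae_of_all _ fun ω => mul_nonneg (by positivity) (mul_nonneg (by positivity) (hy0 _)))]
    refine lintegral_mono fun ω => ENNReal.ofReal_le_ofReal (le_trans ?_ (hd (φ t ω)))
    have hage : 1 ≤ φ t ω := by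
      obtain ⟨u, rfl⟩ := Nat.exists_eq_add_of_le' ht
      exact s.one_le_aoi c _ n u ω
    obtain ⟨a, ha⟩ := Nat.exists_eq_add_of_le' hage
    rw [ha]
    have h1 : R ^ a ≤ ∑ j ∈ Finset.range (a + 1), R ^ j :=
      Finset.single_le_sum (f := fun j => R ^ j) (fun j _ => by positivity)
        (Finset.self_mem_range_succ a)
    calc d / (R * Y) * (R ^ (a + 1) * y (s.h t ω)) = d * R ^ a * (y (s.h t ω) / Y) := by
          field_simp
          ring
      _ ≤ d * R ^ a := mul_le_of_le_one_right (by positivity) ((div_le_one hY0).2 (hyY _))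
      _ ≤ _ := mul_le_mul_of_nonneg_left h1 hd0.le
  refine tendsto_nhds_top_mono (ENNReal.tendsto_ofReal_atTop.comp
    (hwtop.const_mul_atTop (show 0 < d / (R * Y) by positivity)))
    (eventually_atTop.2 ⟨1, hle⟩)

theorem IsModel.not_stabilizable [IsProbabilityMeasure μ] (hp : ∀ n, (p n).SteadyKalman)
    (hs : s.IsModel c μ) (hN : 0 < N) (hP : c.P ∈ Matrix.rowStochastic ℝ (Fin K))
    (hirr : c.P.IsIrreducible) {v : Fin K → Fin M}
    (hv : ∀ i m, c.on i m = true → c.on i (v i) = true)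
    (h : 1 ≤ (⨆ n, specRad (p n).A) ^ 2 * specRad (c.failure v * c.P)) :
    ¬ s.Stabilizable μ c := by
  have : Nonempty (Fin N) := ⟨⟨0, hN⟩⟩
  obtain ⟨n, hn⟩ := exists_eq_ciSup_of_finite (f := fun n => specRad (p n).A)
  rw [← hn] at h
  -- The failure matrix is substochastic, so its spectral radius is at most `1` and the process
  -- attaining the maximum is non-decaying.
  have hρ : 1 ≤ specRad (p n).A := by
    have h1 := h.trans (mul_le_of_le_one_right (sq_nonneg _)
      (Channel.specRad_failure_mul_le_one hP v))
    exact (one_le_sq_iff₀ (specRad_nonneg _)).1 h1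
  rintro ⟨π, hπ⟩
  refine hπ.ne (avgCost_eq_top_of_tendsto_mse (n := n) ?_)
  -- Without an on state there is nothing to charge; at `ρ = 1` divergence then rests on the linear
  -- growth of the covariance with the age.
  by_cases hon : ∃ i, c.on i (v i) = true
  · obtain ⟨i₀, hi₀⟩ := hon
    exact hs.tendsto_mse_of_exists_on hp hirr π hρ hv h hi₀
  · exact hs.tendsto_mse_of_never_on hp π hρ fun i m hm => hon ⟨i, hv i m hm⟩

end Sources

end RemoteEstimation


open RemoteEstimation in
theorem theorem2 {N M K : ℕ} (hM : 1 ≤ M) (hMN : M < N)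
    (p : Fin N → Plant) (hp : ∀ n, (p n).SteadyKalman)
    (c : Channel M K) (hc : c.Ergodic)
    {Ω : Type*} [MeasurableSpace Ω] (μ : Measure Ω) [IsProbabilityMeasure μ]
    (s : Sources Ω p K) (hs : s.IsModel c μ) :
    (s.Stabilizable μ c ↔ (⨆ n, specRad (p n).A) ^ 2 * c.rateInf < 1) ∧
    c.rateInf = c.rate 1 ∧
    (∃ v : Fin K → Fin M, ∀ v' i j, c.failure v i j ≤ c.failure v' i j) ∧
    (∀ v : Fin K → Fin M, (∀ v' i j, c.failure v i j ≤ c.failure v' i j) →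
      ∀ L : ℕ, 1 ≤ L → c.rate L = c.prodRate L (fun _ => v)) := by
  have hP := hc.stochastic
  have hP0 : ∀ i j, 0 ≤ c.P i j := hc.irreducible.nonneg
  obtain ⟨v, hv⟩ := c.exists_failure_le hM
  have hN : 0 < N := by omega
  refine ⟨?_, ?_, ⟨v, hv⟩, fun u hu L _ => Channel.rate_eq_prodRate hP0 hu L⟩
  · rw [Channel.rateInf_eq_specRad hP0 hv]
    refine ⟨fun h => ?_, fun h => hs.stabilizable hp hN hP v h⟩
    by_contra! hlt
    exact hs.not_stabilizable hp hN hP hc.irreducible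
      (fun i m hm => Channel.on_of_failure_le hv hm) hlt h
  · rw [Channel.rateInf_eq_specRad hP0 hv, Channel.rate_eq_specRad hP0 hv le_rfl]
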